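/- Let $p$ be a prime number, let $k$ be a commutative ring of characteristic $p$ and let $A$ be a commutative $k$-algebra. For an integer $m\ge 1$, a $k$-derivation $\delta:A\to A$ is called $m$-integrable if there are $k$-linear maps $D_0=\mathrm{Id}_A, D_1=\delta, D_2,\dots,D_m:A\to A$ with $D_n(xy)=\sum_{i+j=n}D_i(x)D_j(y)$ for all $x,y\in A$ and all $n\le m$ (a Hasse–Schmidt derivation of length $m$); it is called $f$-integrable if it is $m$-integrable for all integers $m\ge 1$. Let $\mathrm{IDer}_k(A;m)$ and $\mathrm{IDer}^f_k(A)$ be the sets of $m$-integrable, respectively $f$-integrable, $k$-derivations of $A$. Then, for every integer $m\ge 1$: (1) if $\delta\in \mathrm{IDer}_k(A;m)$, then the $p$-th iterate $\delta^p$ belongs to $\mathrm{IDer}_k(A;m)$; (2) $\mathrm{IDer}_k(A;m)$ is an $A$-submodule of $\mathrm{Der}_k(A)$ closed under the bracket $[\delta,\varepsilon]=\delta\varepsilon-\varepsilon\delta$, and with the inclusion into $\mathrm{Der}_k(A)$ as anchor and the $p$-operation $\delta^{[p]}=\delta^p$ it is a restricted Lie–Rinehart algebra over $A/k$. Likewise,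 $\delta^p\in\mathrm{IDer}^f_k(A)$ for every $\delta\in\mathrm{IDer}^f_k(A)$, and $\mathrm{IDer}^f_k(A)$ is, with the same structure, a restricted Lie–Rinehart algebra over $A/k$. Here a Lie–Rinehart algebra $L$ over $A/k$ with anchor $\varrho:L\to \mathrm{Der}_k(A)$ is called restricted, with $p$-operation $\lambda\mapsto\lambda^{[p]}$ on $L$, if for all $\lambda,\mu\in L$, $c\in k$, $a\in A$: $(c\lambda)^{[p]}=c^p\lambda^{[p]}$; $\operatorname{ad}(\lambda^{[p]})=\operatorname{ad}(\lambda)^p$; $(\lambda+\mu)^{[p]}=\lambda^{[p]}+\mu^{[p]}+\sum_{i=1}^{p-1}s_i(\lambda,\mu)$, where $i\,s_i(\lambda,\mu)$ is the coefficient of $T^{i-1}$ in $\operatorname{ad}(T\lambda+\mu)^{p-1}(\lambda)$; and $(a\lambda)^{[p]}=a^p\lambda^{[p]}+\varrho(a\lambda)^{p-1}(a)\,\lambda$. -/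

import Mathlib

/-- A Hasse–Schmidt derivation of length `m` of `A` over `k`: a family `D₀, …, D_m` of `k`-linear
endomorphisms of `A` with `D₀ = id` and `D_n (x y) = ∑_{i + j = n} D_i x * D_j y` for `n ≤ m`.
The family is stored as a sequence that vanishes beyond `m`, so that two Hasse–Schmidt derivations
of length `m` are equal exactly when their components of index at most `m` are. -/
structure HasseSchmidtDerivation (k A : Type*) [CommRing k] [CommRing A] [Algebra k A]
    (m : ℕ) where
  coeff : ℕ → A →ₗ[k] A
  coeff_zero : coeff 0 = LinearMap.id
  coeff_mul : ∀ n ≤ m, ∀ x y : A,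
    coeff n (x * y) = ∑ ij ∈ Finset.HasAntidiagonal.antidiagonal n, coeff ij.1 x * coeff ij.2 y
  coeff_of_lt : ∀ n, m < n → coeff n = 0

/-- The set `IDer_k(A; m)` of `m`-integrable `k`-derivations of `A` (meaningful for `m ≥ 1`). -/
def IDer (k A : Type*) [CommRing k] [CommRing A] [Algebra k A] (m : ℕ) :
    Set (Derivation k A A) :=
  {δ | ∃ D : HasseSchmidtDerivation k A m, D.coeff 1 = (δ : A →ₗ[k] A)}

/-- The set `IDer^f_k(A)` of `f`-integrable (finite integrable) `k`-derivations of `A`. -/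
def IDerFin (k A : Type*) [CommRing k] [CommRing A] [Algebra k A] :
    Set (Derivation k A A) :=
  {δ | ∀ m : ℕ, 1 ≤ m → δ ∈ IDer k A m}

/-- The iterated Leibniz rule. -/
theorem Derivation.iterate_mul {k A : Type*} [CommRing k] [CommRing A] [Algebra k A]
    (δ : Derivation k A A) (n : ℕ) (a b : A) :
    ((δ : A →ₗ[k] A) ^ n) (a * b) = ∑ ij ∈ Finset.HasAntidiagonal.antidiagonal n,
      n.choose ij.1 • (((δ : A →ₗ[k] A) ^ ij.1) a * ((δ : A →ₗ[k] A) ^ ij.2) b) := by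
  induction n with
  | zero => simp
  | succ n ih =>
    rw [Finset.sum_antidiagonal_choose_succ_nsmul
      (M := A) (fun i j => ((δ : A →ₗ[k] A) ^ i) a * ((δ : A →ₗ[k] A) ^ j) b) n,
      ← Finset.sum_add_distrib, pow_succ', Module.End.mul_apply, ih, map_sum]
    refine Finset.sum_congr rfl fun ij hij => ?_
    obtain ⟨i, j⟩ := ij
    obtain rfl := Finset.HasAntidiagonal.mem_antidiagonal.mp hij
    have hc : (i + j).choose j = (i + j).choose i := by
      rw [Nat.choose_symm_add]
    simp only [map_nsmul, Derivation.coeFn_coe, Derivation.leibniz, smul_eq_mul, pow_succ',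
      Module.End.mul_apply, hc, ← nsmul_add]
    congr 1
    ring

/-- In characteristic `p`, the `p`-th iterate `δ^p` of a `k`-derivation `δ` of `A`
is a `k`-derivation of `A`. -/
def Derivation.charPow {k A : Type*} [CommRing k] [CommRing A] [Algebra k A]
    (p : ℕ) [Fact p.Prime] [CharP k p] (δ : Derivation k A A) : Derivation k A A :=
  Derivation.mk' ((δ : A →ₗ[k] A) ^ p) (by
    intro a b
    have hp : p.Prime := Fact.out
    have hA : (p : A) = 0 := by
      rw [← _root_.map_natCast (algebraMap k A) p, CharP.cast_eq_zero, _root_.map_zero]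
    rw [Derivation.iterate_mul, Finset.Nat.sum_antidiagonal_eq_sum_range_succ
      (fun i j => p.choose i • (((δ : A →ₗ[k] A) ^ i) a * ((δ : A →ₗ[k] A) ^ j) b)),
      Finset.sum_range_succ, Finset.sum_range_eq_add_Ico _ hp.pos, Finset.sum_eq_zero]
    · simp [mul_comm]
    · intro i hi
      rw [Finset.mem_Ico] at hi
      obtain ⟨c, hc⟩ := hp.dvd_choose_self (by omega : i ≠ 0) hi.2
      rw [hc, nsmul_eq_mul, Nat.cast_mul, hA, zero_mul, zero_mul])

theorem Derivation.charPow_apply {k A : Type*} [CommRing k] [CommRing A] [Algebra k A]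
    (p : ℕ) [Fact p.Prime] [CharP k p] (δ : Derivation k A A) (a : A) :
    δ.charPow p a = (δ : A → A)^[p] a := by
  change ((δ : A →ₗ[k] A) ^ p) a = _
  rw [Module.End.pow_apply]
  rfl

/-- Jacobson's element `s_i(x, y)` of a Lie algebra in characteristic `p`, for `1 ≤ i ≤ p - 1`:
the element such that `i • s_i(x, y)` is the coefficient of `T ^ (i - 1)` in
`ad(T x + y)^(p - 1) (x)`. Note that `i` is invertible in `k` when `k` has prime
characteristic `p`. -/
noncomputable def jacobsonS (k : Type*) {L : Type*} [CommRing k] [LieRing L] [LieAlgebra k L]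
    (p i : ℕ) (x y : L) : L :=
  Ring.inverse (i : k) •
    (((Polynomial.X * Polynomial.C (LieAlgebra.ad k L x : Module.End k L) +
      Polynomial.C (LieAlgebra.ad k L y : Module.End k L)) ^ (p - 1)).coeff (i - 1)) x

theorem nsmul_jacobsonS (k : Type*) {L : Type*} [CommRing k] [LieRing L] [LieAlgebra k L]
    (p : ℕ) [Fact p.Prime] [CharP k p] (i : ℕ) (hi : 1 ≤ i) (hip : i < p) (x y : L) :
    i • jacobsonS k p i x y =
      (((Polynomial.X * Polynomial.C (LieAlgebra.ad k L x : Module.End k L) +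
        Polynomial.C (LieAlgebra.ad k L y : Module.End k L)) ^ (p - 1)).coeff (i - 1)) x := by
  have hu : IsUnit (i : k) := by
    rw [CharP.isUnit_natCast_iff (R := k) (Fact.out : p.Prime)]
    exact Nat.not_dvd_of_pos_of_lt hi hip
  rw [jacobsonS, ← Nat.cast_smul_eq_nsmul k, smul_smul, Ring.mul_inverse_cancel _ hu, one_smul]

/-- `pMap` is the `p`-operation of a restricted Lie algebra structure (in the sense of Jacobson)
on the Lie algebra `L` over the ring `k` of prime characteristic `p`. -/
structure IsRestrictedLieAlgebra (k L : Type*) [CommRing k] [LieRing L] [LieAlgebra k L]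
    (p : ℕ) (pMap : L → L) : Prop where
  map_smul : ∀ (c : k) (x : L), pMap (c • x) = c ^ p • pMap x
  map_add : ∀ x y : L,
    pMap (x + y) = pMap x + pMap y + ∑ i ∈ Finset.Ico 1 p, jacobsonS k p i x y
  ad_map : ∀ x : L, LieAlgebra.ad k L (pMap x) = LieAlgebra.ad k L x ^ p

/-- `pMap` is the `p`-operation of a restricted Lie–Rinehart algebra structure on the
Lie–Rinehart algebra `L` over `A / k`, where `k` has prime characteristic `p`:
`L` is a restricted Lie algebra and
`(a x)^[p] = a^p x^[p] + (a x)^(p-1)(a) x`, where `L` acts on `A` through the anchor. -/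
structure IsRestrictedLieRinehart (k A L : Type*) [CommRing k] [CommRing A] [Algebra k A]
    [LieRing L] [LieAlgebra k L] [Module A L] [LieRingModule L A] [LieRinehartRing A L]
    [LieRinehartAlgebra k A L] (p : ℕ) (pMap : L → L) : Prop
    extends IsRestrictedLieAlgebra k L p pMap where
  map_smul_anchor : ∀ (a : A) (x : L), pMap (a • x) =
    a ^ p • pMap x + ((LieRinehartAlgebra.anchor k A L (a • x) : A → A)^[p - 1] a) • x

/-- The set `S` of `k`-derivations of `A` is an `A`-submodule of `Der_k(A)` closed under brackets,
hence a Lie–Rinehart algebra over `A / k` with the inclusion as anchor, and it is a restricted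
Lie–Rinehart algebra with `p`-operation `δ ↦ δ^p`. -/
def IsRestrictedLieRinehartSubalgebra (k A : Type*) [CommRing k] [CommRing A] [Algebra k A]
    (p : ℕ) [Fact p.Prime] [CharP k p] (S : Set (Derivation k A A)) : Prop :=
  ∃ L : LieRinehartSubalgebra A (Derivation k A A), (L : Set (Derivation k A A)) = S ∧
    ∃ pMap : L → L, (∀ δ : L, (pMap δ : Derivation k A A) = (δ : Derivation k A A).charPow p) ∧
      IsRestrictedLieRinehart k A L p pMap

/-! A Hasse–Schmidt derivation is a power series `1 + D₁ t + D₂ t² + …` of operators whose action on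
`A` is multiplicative up to a truncation. With several variables and exponents truncated to a lower
set `Δ`, such series form a group under multiplication (`IsHS.mul`, `IsHS.inv`). Integrability of
the bracket and of the `p`-th power is obtained by building a multivariate series with the desired
operator at the exponent `(1, …, 1)` and extracting a one-variable series from its diagonal.

The main tool is `IsHS.exists_slope`. The part of a series of least slope is again a Hasse–Schmidt
derivation, so it can be divided out; repeating this isolates the part whose slope is that of a
chosen exponent. For the bracket, the group commutator of `D(t₀)` and `E(t₁)` is trivial on both
axes and has coefficient `⁅δ, ε⁆` at `t₀ t₁`; its part of the slope of `(1, 1)` is a series in `t₀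
t₁`.

For the `p`-th power, the product of the `D(t_i)` over `i` in `ZMod p` has coefficient `δ ^ p` at
the product of the variables. It need not be symmetric, but its squarefree coefficients are powers
of `δ` and hence symmetric, and `IsHS.exists_symmetric` corrects the others. For a symmetric series,
the cyclic shift acts on the terms of the Leibniz sum at a diagonal exponent; orbits of size `p`
cancel in characteristic `p`, and only pairs of diagonal exponents remain
(`IsHS.leibniz_diag_of_symmetric`).

The axioms of a restricted structure are then identities between operators, proved by Jacobson's
formula for `(x + y) ^ p` and Hochschild's formula for `(a δ) ^ p`. -/

/-! ### Multivariate Hasse–Schmidt derivations and their parts of constant slope. -/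

section HasseSchmidtSeries

open Finset hiding antidiagonal mem_antidiagonal
open Finset.HasAntidiagonal MvPowerSeries

variable {ι S R : Type*} [Ring S] [CommRing R]

/-- The action of a power series of operators on a power series, extending `φ`. -/
noncomputable def seriesAct (φ : S →+* AddMonoid.End R) (X : MvPowerSeries ι S) (f : MvPowerSeries ι R) :
    MvPowerSeries ι R := by
  classical
  exact fun α => ∑ ij ∈ antidiagonal α, φ (coeff ij.1 X) (coeff ij.2 f)

theorem coeff_seriesAct [DecidableEq ι] (φ : S →+* AddMonoid.End R) (X : MvPowerSeries ι S)
    (f : MvPowerSeries ι R) (α : ι →₀ ℕ) :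
    coeff α (seriesAct φ X f) = ∑ ij ∈ antidiagonal α, φ (coeff ij.1 X) (coeff ij.2 f) := by
  classical
  change (∑ ij ∈ _, _ : R) = _
  congr!

theorem seriesAct_one (φ : S →+* AddMonoid.End R) (f : MvPowerSeries ι R) :
    seriesAct φ (1 : MvPowerSeries ι S) f = f := by
  classical
  ext α
  rw [coeff_seriesAct, Finset.sum_eq_single (0, α)]
  · simp
  · rintro ⟨i, j⟩ hij hne
    rw [mem_antidiagonal] at hij
    have hi : i ≠ 0 := by
      rintro rfl
      simp at hij
      simp [hij] at hne
    simp [coeff_one, hi]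
  · simp

theorem seriesAct_mul (φ : S →+* AddMonoid.End R) (X Y : MvPowerSeries ι S)
    (f : MvPowerSeries ι R) : seriesAct φ (X * Y) f = seriesAct φ X (seriesAct φ Y f) := by
  classical
  ext α
  have e : ∀ ij : (ι →₀ ℕ) × (ι →₀ ℕ), φ (∑ kl ∈ antidiagonal ij.1, coeff kl.1 X * coeff kl.2 Y)
      (coeff ij.2 f) = ∑ kl ∈ antidiagonal ij.1, φ (coeff kl.1 X) (φ (coeff kl.2 Y)
        (coeff ij.2 f)) := fun ij => by
    rw [map_sum]
    refine (AddMonoidHom.finsetSum_apply _ _ _).trans (Finset.sum_congr rfl fun kl _ => ?_)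
    rw [map_mul]
    rfl
  simp only [coeff_seriesAct, coeff_mul, e]
  simp only [map_sum, Finset.sum_sigma']
  refine Finset.sum_nbij' (fun ⟨⟨_, j⟩, ⟨k, l⟩⟩ ↦ ⟨(k, l + j), (l, j)⟩)
    (fun ⟨⟨i, _⟩, ⟨k, l⟩⟩ ↦ ⟨(i + k, l), (i, k)⟩) ?_ ?_ ?_ ?_ ?_ <;>
  · rintro ⟨⟨a, b⟩, ⟨c, d⟩⟩ h
    simp only [mem_sigma, mem_antidiagonal] at h
    obtain ⟨rfl, rfl⟩ := h
    simp [add_assoc]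

theorem coeff_seriesAct_congr (φ : S →+* AddMonoid.End R) {Δ : Set (ι →₀ ℕ)} (hΔ : IsLowerSet Δ)
    (X : MvPowerSeries ι S) {f g : MvPowerSeries ι R} (h : ∀ α ∈ Δ, coeff α f = coeff α g) :
    ∀ α ∈ Δ, coeff α (seriesAct φ X f) = coeff α (seriesAct φ X g) := by
  classical
  intro α hα
  rw [coeff_seriesAct, coeff_seriesAct]
  refine Finset.sum_congr rfl fun ij hij => ?_
  rw [h _ (hΔ (antidiagonal.snd_le hij) hα)]

theorem coeff_seriesAct_C (φ : S →+* AddMonoid.End R) (X : MvPowerSeries ι S) (x : R)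
    (α : ι →₀ ℕ) : coeff α (seriesAct φ X (C x)) = φ (coeff α X) x := by
  classical
  rw [coeff_seriesAct, Finset.sum_eq_single (α, 0)]
  · simp
  · rintro ⟨i, j⟩ hij hne
    rw [mem_antidiagonal] at hij
    have hi : j ≠ 0 := by
      rintro rfl
      simp at hij
      simp [hij] at hne
    simp [coeff_C, hi]
  · simp

/-- A multivariate Hasse–Schmidt derivation, indexed by the exponents in `Δ`, of the ring `R`,
with coefficients in a ring `S` that acts on `R` through `φ`. -/
structure IsHS (φ : S →+* AddMonoid.End R) (Δ : Set (ι →₀ ℕ)) (X : MvPowerSeries ι S) : Prop where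
  coeff_zero : coeff 0 X = 1
  coeff_seriesAct_C_mul : ∀ α ∈ Δ, ∀ x y : R, coeff α (seriesAct φ X (C (x * y))) =
    coeff α (seriesAct φ X (C x) * seriesAct φ X (C y))

theorem isHS_iff [DecidableEq ι] (φ : S →+* AddMonoid.End R) (Δ : Set (ι →₀ ℕ))
    (X : MvPowerSeries ι S) : IsHS φ Δ X ↔ coeff 0 X = 1 ∧ ∀ α ∈ Δ, ∀ x y : R,
      φ (coeff α X) (x * y) =
        ∑ ij ∈ antidiagonal α, φ (coeff ij.1 X) x * φ (coeff ij.2 X) y := by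
  constructor
  · rintro ⟨h0, h⟩
    refine ⟨h0, fun α hα x y => ?_⟩
    have := h α hα x y
    simpa only [coeff_mul, coeff_seriesAct_C] using this
  · rintro ⟨h0, h⟩
    refine ⟨h0, fun α hα x y => ?_⟩
    have := h α hα x y
    simpa only [coeff_mul, coeff_seriesAct_C] using this

namespace IsHS

variable {φ : S →+* AddMonoid.End R} {Δ : Set (ι →₀ ℕ)} {X Y : MvPowerSeries ι S}

theorem one : IsHS φ Δ (1 : MvPowerSeries ι S) :=
  ⟨by simp, fun α _ x y => by simp [seriesAct_one]⟩

/-- The action commutes with multiplication by the variables, so multiplicativity on constants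
propagates to all series. The exponents of the factors stay in `Δ` because it is a lower set. -/
theorem coeff_seriesAct_mul (hΔ : IsLowerSet Δ) (hX : IsHS φ Δ X) (f g : MvPowerSeries ι R) :
    ∀ α ∈ Δ, coeff α (seriesAct φ X (f * g)) =
      coeff α (seriesAct φ X f * seriesAct φ X g) := by
  classical
  intro α hα
  have h := ((isHS_iff φ Δ X).1 hX).2
  have e : coeff α (seriesAct φ X (f * g)) = ∑ ij ∈ antidiagonal α,
      ∑ kl ∈ antidiagonal ij.2, ∑ uv ∈ antidiagonal ij.1,
        φ (coeff uv.1 X) (coeff kl.1 f) * φ (coeff uv.2 X) (coeff kl.2 g) := by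
    rw [coeff_seriesAct]
    refine Finset.sum_congr rfl fun ij hij => ?_
    rw [coeff_mul, map_sum]
    refine Finset.sum_congr rfl fun kl hkl => ?_
    rw [h _ (hΔ (antidiagonal.fst_le hij) hα)]
  rw [e]
  simp only [coeff_mul, coeff_seriesAct, Finset.sum_mul_sum, Finset.sum_sigma']
  refine Finset.sum_nbij'
    (fun ⟨⟨_, _⟩, ⟨⟨k, l⟩, ⟨u, v⟩⟩⟩ => ⟨(u + k, v + l), ⟨(u, k), (v, l)⟩⟩)
    (fun ⟨⟨_, _⟩, ⟨⟨u, k⟩, ⟨v, l⟩⟩⟩ => ⟨(u + v, k + l), ⟨(k, l), (u, v)⟩⟩) ?_ ?_ ?_ ?_ ?_ <;>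
  · rintro ⟨⟨a, b⟩, ⟨⟨c, d⟩, ⟨e, f⟩⟩⟩ h
    simp only [mem_sigma, mem_antidiagonal] at h
    obtain ⟨rfl, rfl, rfl⟩ := h
    simp [add_add_add_comm]

theorem mul (hΔ : IsLowerSet Δ) (hX : IsHS φ Δ X) (hY : IsHS φ Δ Y) : IsHS φ Δ (X * Y) := by
  classical
  refine ⟨by simpa [coeff_mul, hX.coeff_zero] using hY.coeff_zero, fun α hα x y => ?_⟩
  simp only [seriesAct_mul]
  rw [coeff_seriesAct_congr φ hΔ X (hY.coeff_seriesAct_C_mul · · x y) α hα,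
    hX.coeff_seriesAct_mul hΔ _ _ α hα]

/-- Applying `X` to the product of `Y x` and `Y y` gives `x y` on `Δ`; applying `Y` to both sides
gives multiplicativity of `Y`. -/
theorem of_mul_eq_one (hΔ : IsLowerSet Δ) (hX : IsHS φ Δ X) (h : X * Y = 1) (h' : Y * X = 1) :
    IsHS φ Δ Y := by
  classical
  refine ⟨?_, fun α hα x y => ?_⟩
  · have := congrArg (coeff 0) h
    simpa [coeff_mul, hX.coeff_zero] using this
  · have e := hX.coeff_seriesAct_mul hΔ (seriesAct φ Y (C x)) (seriesAct φ Y (C y))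
    simp only [← seriesAct_mul, h, seriesAct_one, ← map_mul] at e
    rw [← coeff_seriesAct_congr φ hΔ Y e α hα, ← seriesAct_mul, h', seriesAct_one]

end IsHS

/-- The inverse of a power series with constant coefficient `1`. -/
noncomputable def seriesInv (X : MvPowerSeries ι S) : MvPowerSeries ι S := X.invOfUnit 1

theorem mul_seriesInv {X : MvPowerSeries ι S} (h : coeff 0 X = 1) : X * seriesInv X = 1 :=
  mul_invOfUnit X 1 (by simpa using h)

theorem seriesInv_mul {X : MvPowerSeries ι S} (h : coeff 0 X = 1) : seriesInv X * X = 1 :=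
  invOfUnit_mul X 1 (by simpa using h)

theorem coeff_zero_seriesInv (X : MvPowerSeries ι S) : coeff 0 (seriesInv X) = 1 := by
  simp [seriesInv]

theorem IsHS.inv {φ : S →+* AddMonoid.End R} {Δ : Set (ι →₀ ℕ)} {X : MvPowerSeries ι S}
    (hΔ : IsLowerSet Δ) (hX : IsHS φ Δ X) : IsHS φ Δ (seriesInv X) :=
  hX.of_mul_eq_one hΔ (mul_seriesInv hX.coeff_zero) (seriesInv_mul hX.coeff_zero)

/-- The power series `X` agrees with `1` at the exponents in `T`. -/
def TrivialOn (T : Set (ι →₀ ℕ)) (X : MvPowerSeries ι S) : Prop :=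
  coeff 0 X = 1 ∧ ∀ α ∈ T, α ≠ 0 → coeff α X = 0

theorem TrivialOn.one (T : Set (ι →₀ ℕ)) : TrivialOn T (1 : MvPowerSeries ι S) := by
  classical
  exact ⟨by simp, fun α _ h => by simp [coeff_one, h]⟩

/-- If `X` and `Y` have constant coefficient `1` and the coefficients of `X` below `α` vanish, then
the coefficient of `X * Y` at `α` is the sum of those of `X` and `Y`. -/
theorem coeff_mul_of_lt {X Y : MvPowerSeries ι S} (hX : coeff 0 X = 1) (hY : coeff 0 Y = 1)
    {α : ι →₀ ℕ} (hα : α ≠ 0)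
    (h : ∀ β γ, β + γ = α → β ≠ 0 → γ ≠ 0 → coeff β X = 0 ∨ coeff γ Y = 0) :
    coeff α (X * Y) = coeff α X + coeff α Y := by
  classical
  have hsub : ({(α, 0), (0, α)} : Finset _) ⊆ antidiagonal α := by
    intro x hx
    simp only [mem_insert, mem_singleton] at hx
    rcases hx with rfl | rfl <;> simp
  rw [coeff_mul, ← Finset.sum_subset hsub, Finset.sum_pair (by simp [hα]), hX, hY, mul_one,
    one_mul]
  rintro ⟨β, γ⟩ hβγ hne
  rw [mem_antidiagonal] at hβγ
  simp only at hβγ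
  subst hβγ
  rcases h β γ rfl (by rintro rfl; simp at hne) (by rintro rfl; simp at hne) with h | h <;>
    simp [h]

section TrivialOn

variable {T : Set (ι →₀ ℕ)} {X Y : MvPowerSeries ι S}

theorem TrivialOn.coeff_mul (hX : TrivialOn T X) (hY : coeff 0 Y = 1)
    {α : ι →₀ ℕ} (hα : α ≠ 0) (h : ∀ β < α, β ∈ T) :
    coeff α (X * Y) = coeff α X + coeff α Y := by
  refine coeff_mul_of_lt hX.1 hY hα ?_
  rintro β γ rfl h1 h2
  exact .inl (hX.2 _ (h _ (lt_add_of_pos_right _ (pos_iff_ne_zero.2 h2))) h1)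

theorem TrivialOn.mul (hT : IsLowerSet T) (hX : TrivialOn T X) (hY : TrivialOn T Y) :
    TrivialOn T (X * Y) := by
  classical
  refine ⟨by simpa [MvPowerSeries.coeff_mul, hX.1] using hY.1, fun α hα h => ?_⟩
  rw [hX.coeff_mul hY.1 h fun β hβ => hT hβ.le hα, hX.2 α hα h, hY.2 α hα h, add_zero]

theorem TrivialOn.inv (hT : IsLowerSet T) (hX : TrivialOn T X) :
    TrivialOn T (seriesInv X) := by
  classical
  refine ⟨coeff_zero_seriesInv X, fun α hα h => ?_⟩
  have := hX.coeff_mul (coeff_zero_seriesInv X) h fun β hβ => hT hβ.le hα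
  rw [mul_seriesInv hX.1, coeff_one, if_neg h, hX.2 α hα h, zero_add] at this
  exact this.symm

end TrivialOn

/-- The part of a power series supported on the kernel of `μ`. -/
noncomputable def seriesProj (μ : (ι →₀ ℕ) →+ ℚ) (X : MvPowerSeries ι S) : MvPowerSeries ι S :=
  fun α => if μ α = 0 then coeff α X else 0

theorem coeff_seriesProj (μ : (ι →₀ ℕ) →+ ℚ) (X : MvPowerSeries ι S) (α : ι →₀ ℕ) :
    coeff α (seriesProj μ X) = if μ α = 0 then coeff α X else 0 := rfl

theorem TrivialOn.proj {T : Set (ι →₀ ℕ)} {X : MvPowerSeries ι S} (μ : (ι →₀ ℕ) →+ ℚ)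
    (hX : TrivialOn T X) : TrivialOn T (seriesProj μ X) := by
  refine ⟨by simp [coeff_seriesProj, hX.1], fun α hα h => ?_⟩
  simp [coeff_seriesProj, hX.2 α hα h]

/-- When `μ` is nonnegative on the support, two exponents of the support whose sum has `μ = 0` both
have `μ = 0`. Thus the face `μ = 0` satisfies the Leibniz rule by itself. -/
theorem IsHS.proj {φ : S →+* AddMonoid.End R} {Δ : Set (ι →₀ ℕ)} {X : MvPowerSeries ι S}
    (hΔ : IsLowerSet Δ) (hX : IsHS φ Δ X) (μ : (ι →₀ ℕ) →+ ℚ)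
    (hμ : ∀ α ∈ Δ, μ α < 0 → coeff α X = 0) : IsHS φ Δ (seriesProj μ X) := by
  classical
  obtain ⟨h0, h⟩ := (isHS_iff φ Δ X).1 hX
  refine (isHS_iff φ Δ _).2 ⟨by simp [coeff_seriesProj, h0], fun α hα x y => ?_⟩
  by_cases hz : μ α = 0
  · rw [coeff_seriesProj, if_pos hz, h α hα]
    refine Finset.sum_congr rfl fun ij hij => ?_
    have hi := hΔ (antidiagonal.fst_le hij) hα
    have hj := hΔ (antidiagonal.snd_le hij) hα
    rw [mem_antidiagonal] at hij
    rw [← hij, map_add] at hz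
    rcases lt_trichotomy (μ ij.1) 0 with hlt | he | hgt
    · simp [coeff_seriesProj, hμ _ hi hlt]
    · have he' : μ ij.2 = 0 := by linarith
      simp [coeff_seriesProj, he, he']
    · simp [coeff_seriesProj, hμ _ hj (by linarith), hgt.ne']
  · rw [coeff_seriesProj, if_neg hz, map_zero, Finset.sum_eq_zero]
    · rfl
    intro ij hij
    rw [mem_antidiagonal] at hij
    rw [← hij, map_add] at hz
    by_cases h1 : μ ij.1 = 0
    · have h2 : μ ij.2 ≠ 0 := by rwa [h1, zero_add] at hz
      simp [coeff_seriesProj, h2]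
    · simp [coeff_seriesProj, h1]

/-- Write `X = P Z` with `P` the projection. Since `P` lives on `μ = 0`, a mixed term at `α`
involves a smaller coefficient of `Z` with the same value of `μ`, which vanishes by induction. What
remains is `coeff α X - coeff α P`, and this is zero when `μ α ≤ 0`. -/
theorem coeff_seriesInv_seriesProj_mul {Δ : Set (ι →₀ ℕ)} {X : MvPowerSeries ι S}
    (hΔ : IsLowerSet Δ) (hX : coeff 0 X = 1) (μ : (ι →₀ ℕ) →+ ℚ)
    (hμ : ∀ α ∈ Δ, μ α < 0 → coeff α X = 0) :
    ∀ α ∈ Δ, μ α ≤ 0 → α ≠ 0 → coeff α (seriesInv (seriesProj μ X) * X) = 0 := by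
  classical
  have hP : coeff 0 (seriesProj μ X) = 1 := by simp [coeff_seriesProj, hX]
  set Z := seriesInv (seriesProj μ X) * X with hZ
  have hZ0 : coeff 0 Z = 1 := by simp [hZ, coeff_mul, hX, coeff_zero_seriesInv]
  have hPZ : seriesProj μ X * Z = X := by rw [hZ, ← mul_assoc, mul_seriesInv hP, one_mul]
  intro α
  induction α using WellFoundedLT.induction with
  | _ α ih =>
  intro hα hle hne
  have key := coeff_mul_of_lt (X := seriesProj μ X) (Y := Z) hP hZ0 hne (by
    rintro β γ rfl h1 h2
    by_cases hb : μ β = 0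
    · refine .inr (ih γ (lt_add_of_pos_left _ (pos_iff_ne_zero.2 h1)) (hΔ le_add_self hα) ?_ h2)
      simpa [hb] using hle
    · exact .inl (by simp [coeff_seriesProj, hb]))
  rw [hPZ, coeff_seriesProj] at key
  rcases hle.lt_or_eq with hlt | heq
  · simpa [hlt.ne, hμ α hα hlt] using key.symm
  · simpa [heq] using key

/-- The linear functional whose sign at `β` compares the slope `ℓ β / degree β` with `q`. -/
noncomputable def slopeFunctional (ℓ : (ι →₀ ℕ) →+ ℚ) (q : ℚ) : (ι →₀ ℕ) →+ ℚ where
  toFun β := ℓ β - q * (β.degree : ℚ)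
  map_zero' := by simp
  map_add' x y := by simp; ring

theorem slopeFunctional_apply (ℓ : (ι →₀ ℕ) →+ ℚ) (q : ℚ) (β : ι →₀ ℕ) :
    slopeFunctional ℓ q β = ℓ β - q * (β.degree : ℚ) := rfl

theorem degree_cast_pos {β : ι →₀ ℕ} (h : β ≠ 0) : (0 : ℚ) < (β.degree : ℚ) := by
  have : β.degree ≠ 0 := by simpa [Finsupp.degree_eq_zero_iff] using h
  positivity

/-- A coefficient of a multivariate Hasse–Schmidt derivation, minimal outside a lower set on which
the derivation is trivial, is also a coefficient of one whose exponents have a constant slope. -/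
theorem IsHS.exists_slope {φ : S →+* AddMonoid.End R} {Δ T : Set (ι →₀ ℕ)} (hΔ : IsLowerSet Δ)
    (hfin : Δ.Finite) (hT : IsLowerSet T) (ℓ : (ι →₀ ℕ) →+ ℚ) {α : ι →₀ ℕ} (hα0 : α ≠ 0)
    (hαT : ∀ β < α, β ∈ T) (X : MvPowerSeries ι S)
    (hX : IsHS φ Δ X) (hXT : TrivialOn T X) :
    ∃ Y, IsHS φ Δ Y ∧ TrivialOn T Y ∧ coeff α Y = coeff α X ∧
      ∀ β, ℓ β * α.degree ≠ ℓ α * β.degree → coeff β Y = 0 := by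
  classical
  set s : (ι →₀ ℕ) → ℚ := fun β => ℓ β / β.degree with hs
  have hneg : ∀ q β, β ≠ 0 → (slopeFunctional ℓ q β < 0 ↔ s β < q) := fun q β hβ => by
    rw [slopeFunctional_apply, hs, div_lt_iff₀ (degree_cast_pos hβ), sub_neg]
  have hle : ∀ q β, β ≠ 0 → (slopeFunctional ℓ q β ≤ 0 ↔ s β ≤ q) := fun q β hβ => by
    rw [slopeFunctional_apply, hs, div_le_iff₀ (degree_cast_pos hβ), sub_nonpos]
  have heq : ∀ q β, β ≠ 0 → (slopeFunctional ℓ q β = 0 ↔ s β = q) := fun q β hβ => by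
    rw [slopeFunctional_apply, hs, div_eq_iff (degree_cast_pos hβ).ne', sub_eq_zero]
  -- Induction measure: the exponents of slope below that of `α` that are not yet below every slope
  -- occurring in `X`.
  let N : MvPowerSeries ι S → Finset (ι →₀ ℕ) := fun X => hfin.toFinset.filter fun γ =>
    γ ≠ 0 ∧ s γ < s α ∧ ∃ β ∈ Δ, β ≠ 0 ∧ coeff β X ≠ 0 ∧ s β ≤ s γ
  induction hn : N X using Finset.strongInduction generalizing X with
  | _ F ih =>
  subst hn
  by_cases hex : ∃ β ∈ Δ, β ≠ 0 ∧ coeff β X ≠ 0 ∧ s β < s α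
  · let B := hfin.toFinset.filter fun β => β ≠ 0 ∧ coeff β X ≠ 0
    have hB : B.Nonempty := by
      obtain ⟨β, h1, h2, h3, -⟩ := hex
      exact ⟨β, by simp [B, h1, h2, h3]⟩
    -- `β` realizes the least slope in the support; dividing by the part of that slope removes it
    -- and creates no smaller slope.
    obtain ⟨β, hβ, hmin⟩ := B.exists_min_image s hB
    have hβα : s β < s α := by
      obtain ⟨β', h1, h2, h3, h4⟩ := hex
      exact (hmin β' (by simp [B, h1, h2, h3])).trans_lt h4
    simp only [B, mem_filter, Set.Finite.mem_toFinset] at hβ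
    obtain ⟨hβΔ, hβ0, hβX⟩ := hβ
    have hsupp : ∀ γ ∈ Δ, slopeFunctional ℓ (s β) γ < 0 → coeff γ X = 0 := by
      intro γ hγ hlt
      by_contra hne
      have hγ0 : γ ≠ 0 := by rintro rfl; simp at hlt
      exact absurd ((hneg _ _ hγ0).1 hlt) (not_lt.2 (hmin γ (by simp [B, hγ, hγ0, hne])))
    have hP := hX.proj hΔ _ hsupp
    have hPT := hXT.proj (slopeFunctional ℓ (s β))
    set P := seriesProj (slopeFunctional ℓ (s β)) X with hPdef
    have hZ := coeff_seriesInv_seriesProj_mul hΔ hX.coeff_zero _ hsupp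
    have hZT := (hPT.inv hT).mul hT hXT
    -- The part divided out has no coefficient at `α`, whose slope is larger, and below `α`
    -- everything is trivial.
    have hZα : coeff α (seriesInv P * X) = coeff α X := by
      have h1 : P * (seriesInv P * X) = X := by
        rw [← mul_assoc, mul_seriesInv hP.coeff_zero, one_mul]
      have h2 := hPT.coeff_mul hZT.1 hα0 hαT
      rw [h1, hPdef, coeff_seriesProj, if_neg, zero_add] at h2
      · exact h2.symm
      · rw [heq _ _ hα0]
        exact hβα.ne'
    have hlt : N (seriesInv P * X) ⊂ N X := by
      refine Finset.ssubset_iff_subset_ne.2 ⟨?_, ?_⟩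
      · intro γ hγ
        simp only [N, mem_filter, Set.Finite.mem_toFinset] at hγ ⊢
        obtain ⟨h1, h2, h3, γ', h4, h5, h6, h7⟩ := hγ
        refine ⟨h1, h2, h3, β, hβΔ, hβ0, hβX, le_trans ?_ h7⟩
        by_contra hcon
        exact h6 (hZ γ' h4 ((hle _ _ h5).2 (not_le.1 hcon).le) h5)
      · intro he
        have : β ∈ N X := by
          simp only [N, mem_filter, Set.Finite.mem_toFinset]
          exact ⟨hβΔ, hβ0, hβα, β, hβΔ, hβ0, hβX, le_rfl⟩
        rw [← he] at this
        simp only [N, mem_filter, Set.Finite.mem_toFinset] at this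
        obtain ⟨-, -, -, γ', h4, h5, h6, h7⟩ := this
        exact h6 (hZ γ' h4 ((hle _ _ h5).2 h7) h5)
    obtain ⟨Y, h1, h2, h3, h4⟩ := ih _ hlt _ ((hP.inv hΔ).mul hΔ hX) hZT rfl
    exact ⟨Y, h1, h2, h3.trans hZα, h4⟩
  -- No slope below that of `α` is left, so the projection onto the slope of `α` is itself a
  -- Hasse–Schmidt derivation.
  · push Not at hex
    refine ⟨seriesProj (slopeFunctional ℓ (s α)) X, hX.proj hΔ _ ?_, hXT.proj _, ?_, ?_⟩
    · intro γ hγ hlt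
      by_contra hne
      have hγ0 : γ ≠ 0 := by rintro rfl; simp at hlt
      exact absurd ((hneg _ _ hγ0).1 hlt) (not_lt.2 (hex γ hγ hγ0 hne))
    · rw [coeff_seriesProj, if_pos ((heq _ _ hα0).2 rfl)]
    · intro γ hγ
      rw [coeff_seriesProj, if_neg]
      rw [slopeFunctional_apply, hs]
      intro h
      apply hγ
      have := (degree_cast_pos hα0).ne'
      field_simp at h
      linarith

end HasseSchmidtSeries

/-! ### One-variable series inside several variables, and diagonal series. -/

section IntegrableDerivations

open Finset hiding antidiagonal mem_antidiagonal
open Finset.HasAntidiagonal MvPowerSeries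

/-- The exponent all of whose entries are `n`. -/
noncomputable def diagExponent (ι : Type*) [Finite ι] (n : ℕ) : ι →₀ ℕ :=
  Finsupp.equivFunOnFinite.symm fun _ => n

@[simp]
theorem diagExponent_apply {ι : Type*} [Finite ι] (n : ℕ) (i : ι) : diagExponent ι n i = n := rfl

theorem diagExponent_injective (ι : Type*) [Finite ι] [Nonempty ι] :
    Function.Injective (diagExponent ι) := fun a b h => by
  simpa using DFunLike.congr_fun h (Classical.arbitrary ι)

theorem diagExponent_zero (ι : Type*) [Finite ι] : diagExponent ι 0 = 0 := by ext; simp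

theorem diagExponent_add (ι : Type*) [Finite ι] (a b : ℕ) :
    diagExponent ι (a + b) = diagExponent ι a + diagExponent ι b := by ext; simp

theorem diagExponent_mem_Iic {ι : Type*} [Finite ι] {n m : ℕ} (h : n ≤ m) :
    diagExponent ι n ∈ Set.Iic (diagExponent ι m) := fun _ => by simpa using h

variable {ι S R : Type*} [Ring S] [CommRing R]

/-- The power series `∑ D_n t_i ^ n`. -/
noncomputable def curveSeries (i : ι) (D : ℕ → S) : MvPowerSeries ι S := by
  classical
  exact fun α => if α = Finsupp.single i (α i) then D (α i) else 0

theorem coeff_curveSeries [DecidableEq ι] (i : ι) (D : ℕ → S) (α : ι →₀ ℕ) :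
    coeff α (curveSeries i D) = if α = Finsupp.single i (α i) then D (α i) else 0 := by
  classical
  rw [coeff_apply, curveSeries]
  congr!

theorem coeff_single_curveSeries (i : ι) (D : ℕ → S) (n : ℕ) :
    coeff (Finsupp.single i n) (curveSeries i D) = D n := by
  classical
  simp [coeff_curveSeries]

theorem coeff_curveSeries_of_ne (i : ι) (D : ℕ → S) {α : ι →₀ ℕ}
    (h : α ≠ Finsupp.single i (α i)) : coeff α (curveSeries i D) = 0 := by
  classical
  rw [coeff_curveSeries, if_neg h]

theorem coeff_zero_curveSeries (i : ι) {D : ℕ → S} (h0 : D 0 = 1) :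
    coeff 0 (curveSeries i D) = 1 := by
  simpa [h0] using coeff_single_curveSeries i D 0

theorem sum_antidiagonal_single {M : Type*} [AddCommMonoid M] [DecidableEq ι] (i : ι) (n : ℕ)
    (f : (ι →₀ ℕ) × (ι →₀ ℕ) → M) :
    ∑ ij ∈ antidiagonal (Finsupp.single i n), f ij =
      ∑ ij ∈ antidiagonal n, f (Finsupp.single i ij.1, Finsupp.single i ij.2) := by
  rw [Finsupp.antidiagonal_single, Finset.sum_map]
  rfl

theorem isHS_curveSeries {φ : S →+* AddMonoid.End R} [Finite ι] (i : ι) {D : ℕ → S} {m : ℕ}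
    (h0 : D 0 = 1) (h : ∀ n ≤ m, ∀ x y : R, φ (D n) (x * y) =
      ∑ ij ∈ antidiagonal n, φ (D ij.1) x * φ (D ij.2) y) :
    IsHS φ (Set.Iic (diagExponent ι m)) (curveSeries i D) := by
  classical
  refine (isHS_iff φ _ _).2 ⟨coeff_zero_curveSeries i h0, fun α hα x y => ?_⟩
  by_cases hs : α = Finsupp.single i (α i)
  · rw [hs, sum_antidiagonal_single, coeff_single_curveSeries, h _ (hα i)]
    simp only [coeff_single_curveSeries]
  · rw [coeff_curveSeries_of_ne i D hs, map_zero, Finset.sum_eq_zero]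
    · rfl
    rintro ⟨β, γ⟩ hβγ
    rw [mem_antidiagonal] at hβγ
    simp only at hβγ
    by_cases h1 : β = Finsupp.single i (β i)
    · by_cases h2 : γ = Finsupp.single i (γ i)
      · exfalso
        apply hs
        rw [← hβγ, Finsupp.add_apply, Finsupp.single_add, ← h1, ← h2]
      · simp [coeff_curveSeries_of_ne i D h2]
    · simp [coeff_curveSeries_of_ne i D h1]

theorem coeff_curveSeries_mul (i : ι) (D : ℕ → S) (P : MvPowerSeries ι S)
    (hP : ∀ γ : ι →₀ ℕ, γ i ≠ 0 → coeff γ P = 0) (α : ι →₀ ℕ) :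
    coeff α (curveSeries i D * P) = D (α i) * coeff (α.erase i) P := by
  classical
  rw [coeff_mul, Finset.sum_eq_single (Finsupp.single i (α i), α.erase i),
    coeff_single_curveSeries]
  · rintro ⟨β, γ⟩ hβγ hne
    rw [mem_antidiagonal] at hβγ
    simp only at hβγ ⊢
    by_cases h1 : β = Finsupp.single i (β i)
    · rw [hP γ, mul_zero]
      intro h2
      apply hne
      have hαi : α i = β i := by rw [← hβγ]; simp [h2]
      have h3 : Finsupp.single i (α i) = β := by rw [hαi]; exact h1.symm
      rw [h3, ← hβγ, Finsupp.erase_add]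
      congr 1
      rw [h1, Finsupp.erase_single, zero_add, Finsupp.erase_of_notMem_support (by simpa using h2)]
    · rw [coeff_curveSeries_of_ne i D h1, zero_mul]
  · intro h
    exact absurd (mem_antidiagonal.2 (Finsupp.single_add_erase i α)) h

theorem coeff_mul_eq_zero_of_right {T : Set (ι →₀ ℕ)} (hT : IsLowerSet T) {X : MvPowerSeries ι S}
    (hX : ∀ α ∈ T, coeff α X = 0) (Y : MvPowerSeries ι S) : ∀ α ∈ T, coeff α (Y * X) = 0 := by
  classical
  intro α hα
  rw [coeff_mul]
  exact Finset.sum_eq_zero fun ij hij => by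
    rw [hX _ (hT (antidiagonal.snd_le hij) hα), mul_zero]

theorem coeff_mul_eq_zero_of_left {T : Set (ι →₀ ℕ)} (hT : IsLowerSet T) {X : MvPowerSeries ι S}
    (hX : ∀ α ∈ T, coeff α X = 0) (Y : MvPowerSeries ι S) : ∀ α ∈ T, coeff α (X * Y) = 0 := by
  classical
  intro α hα
  rw [coeff_mul]
  exact Finset.sum_eq_zero fun ij hij => by
    rw [hX _ (hT (antidiagonal.fst_le hij) hα), zero_mul]

theorem trivialOn_iff {T : Set (ι →₀ ℕ)} {X : MvPowerSeries ι S} (hX : coeff 0 X = 1) :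
    TrivialOn T X ↔ ∀ α ∈ T, coeff α (X - 1) = 0 := by
  classical
  constructor
  · rintro ⟨h0, h⟩ α hα
    by_cases hz : α = 0
    · simpa [hz, sub_eq_zero] using hX
    · simp [coeff_one, hz, h α hα hz]
  · intro h
    refine ⟨hX, fun α hα hz => ?_⟩
    simpa [coeff_one, hz] using h α hα

/-- Triviality on a lower set means that `X - 1` lies in the two-sided ideal of series vanishing
there. -/
theorem TrivialOn.conj {T : Set (ι →₀ ℕ)} (hT : IsLowerSet T) {X Y : MvPowerSeries ι S}
    (hX : TrivialOn T X) (hY : coeff 0 Y = 1) : TrivialOn T (Y * X * seriesInv Y) := by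
  classical
  rw [trivialOn_iff (by simp [MvPowerSeries.coeff_mul, hX.1, hY, coeff_zero_seriesInv])]
  have : Y * X * seriesInv Y - 1 = Y * (X - 1) * seriesInv Y := by
    rw [mul_sub, sub_mul, mul_one, mul_seriesInv hY]
  rw [this]
  exact coeff_mul_eq_zero_of_left hT
    (coeff_mul_eq_zero_of_right hT ((trivialOn_iff hX.1).1 hX) Y) _

/-- A multivariate Hasse–Schmidt derivation supported on the diagonal is a Hasse–Schmidt
derivation in one variable. -/
theorem IsHS.leibniz_diag {φ : S →+* AddMonoid.End R} [Finite ι] [Nonempty ι] {m : ℕ}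
    {X : MvPowerSeries ι S} (hX : IsHS φ (Set.Iic (diagExponent ι m)) X)
    (hd : ∀ α, α ∉ Set.range (diagExponent ι) → coeff α X = 0) :
    ∀ n ≤ m, ∀ x y : R, φ (coeff (diagExponent ι n) X) (x * y) = ∑ ij ∈ antidiagonal n,
      φ (coeff (diagExponent ι ij.1) X) x * φ (coeff (diagExponent ι ij.2) X) y := by
  classical
  intro n hn x y
  rw [((isHS_iff φ _ X).1 hX).2 _ (diagExponent_mem_Iic hn)]
  symm
  refine Finset.sum_of_injOn (fun ij => (diagExponent ι ij.1, diagExponent ι ij.2)) ?_ ?_ ?_ ?_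
  · rintro ⟨a, b⟩ - ⟨c, d⟩ - h
    simp only [Prod.mk.injEq] at h
    rw [diagExponent_injective ι h.1, diagExponent_injective ι h.2]
  · rintro ⟨a, b⟩ h
    simp only [mem_coe, mem_antidiagonal] at h ⊢
    rw [← h, diagExponent_add]
  · rintro ⟨β, γ⟩ hβγ hne
    rw [mem_antidiagonal] at hβγ
    simp only at hβγ ⊢
    by_cases h1 : β ∈ Set.range (diagExponent ι)
    · by_cases h2 : γ ∈ Set.range (diagExponent ι)
      · obtain ⟨a, rfl⟩ := h1
        obtain ⟨b, rfl⟩ := h2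
        rw [← diagExponent_add] at hβγ
        exact absurd ⟨(a, b), by simpa using diagExponent_injective ι hβγ, rfl⟩ hne
      · rw [hd γ h2, map_zero]
        exact mul_zero _
    · rw [hd β h1, map_zero]
      exact zero_mul _
  · intro ij _
    rfl

/-! ### Integrable derivations: module operations and bracket. -/

section IDer

variable {k A : Type*} [CommRing k] [CommRing A] [Algebra k A] {m : ℕ}

theorem mem_IDer_iff (hm : 1 ≤ m) {δ : Derivation k A A} : δ ∈ IDer k A m ↔
    ∃ D : ℕ → Module.End k A, D 0 = 1 ∧ D 1 = (δ : A →ₗ[k] A) ∧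
      ∀ n ≤ m, ∀ x y : A, D n (x * y) = ∑ ij ∈ antidiagonal n, D ij.1 x * D ij.2 y := by
  constructor
  · rintro ⟨D, hD⟩
    exact ⟨D.coeff, D.coeff_zero, hD, D.coeff_mul⟩
  · rintro ⟨D, h0, h1, h⟩
    refine ⟨⟨fun n => if n ≤ m then D n else 0, h0, fun n hn x y => ?_,
      fun n hn => by simp [not_le.2 hn]⟩, by simpa [hm] using h1⟩
    rw [if_pos hn, h n hn]
    refine Finset.sum_congr rfl fun ij hij => ?_
    rw [if_pos ((antidiagonal.fst_le hij).trans hn), if_pos ((antidiagonal.snd_le hij).trans hn)]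

theorem exists_isHS_of_mem_IDer [Finite ι] (hm : 1 ≤ m) {δ : Derivation k A A}
    (h : δ ∈ IDer k A m) (i : ι) : ∃ D : ℕ → Module.End k A, D 0 = 1 ∧
      D 1 = (δ : A →ₗ[k] A) ∧
      IsHS (Module.toAddMonoidEnd (Module.End k A) A) (Set.Iic (diagExponent ι m)) (curveSeries i D) := by
  obtain ⟨D, h0, h1, h⟩ := (mem_IDer_iff hm).1 h
  exact ⟨D, h0, h1, isHS_curveSeries i h0 h⟩

theorem mem_IDer_of_isHS [Finite ι] [Nonempty ι] (hm : 1 ≤ m) {δ : Derivation k A A}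
    {X : MvPowerSeries ι (Module.End k A)}
    (hX : IsHS (Module.toAddMonoidEnd (Module.End k A) A) (Set.Iic (diagExponent ι m)) X)
    (hd : ∀ α, α ∉ Set.range (diagExponent ι) → coeff α X = 0)
    (h1 : coeff (diagExponent ι 1) X = (δ : A →ₗ[k] A)) : δ ∈ IDer k A m :=
  (mem_IDer_iff hm).2 ⟨fun n => coeff (diagExponent ι n) X,
    by simp only [diagExponent_zero, hX.coeff_zero], h1, hX.leibniz_diag hd⟩

theorem zero_mem_IDer (hm : 1 ≤ m) : (0 : Derivation k A A) ∈ IDer k A m := by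
  classical
  refine mem_IDer_of_isHS (ι := Unit) hm IsHS.one (fun α hα => ?_) ?_
  · rw [coeff_one, if_neg]
    rintro rfl
    exact hα ⟨0, diagExponent_zero _⟩
  · rw [coeff_one, if_neg]
    · rfl
    · rw [← diagExponent_zero]
      exact (diagExponent_injective Unit).ne one_ne_zero

theorem add_mem_IDer (hm : 1 ≤ m) {δ ε : Derivation k A A} (hδ : δ ∈ IDer k A m)
    (hε : ε ∈ IDer k A m) : δ + ε ∈ IDer k A m := by
  obtain ⟨D, hD0, hD1, hD⟩ := exists_isHS_of_mem_IDer hm hδ ()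
  obtain ⟨E, hE0, hE1, hE⟩ := exists_isHS_of_mem_IDer hm hε ()
  have hs : diagExponent Unit 1 = Finsupp.single () 1 := by ext; simp
  refine mem_IDer_of_isHS hm (hD.mul (isLowerSet_Iic _) hE) (fun α hα => ?_) ?_
  · exact absurd ⟨α (), by ext; simp⟩ hα
  · rw [coeff_mul_of_lt hD.coeff_zero hE.coeff_zero, hs, coeff_single_curveSeries,
      coeff_single_curveSeries, hD1, hE1]
    · rfl
    · rw [hs]
      simp
    · intro β γ h h1 h2
      have h3 := DFunLike.congr_fun h ()
      have h4 : β () ≠ 0 := fun h => h1 (by ext; simpa using h)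
      have h5 : γ () ≠ 0 := fun h => h2 (by ext; simpa using h)
      simp at h3
      omega

theorem smul_mem_IDer (hm : 1 ≤ m) (a : A) {δ : Derivation k A A} (hδ : δ ∈ IDer k A m) :
    a • δ ∈ IDer k A m := by
  obtain ⟨D, h0, h1, h⟩ := (mem_IDer_iff hm).1 hδ
  -- The substitution `t ↦ a t`.
  refine (mem_IDer_iff hm).2 ⟨fun n => a ^ n • D n, by simp [h0], by simp [h1],
    fun n hn x y => ?_⟩
  simp only [LinearMap.smul_apply, h n hn, smul_eq_mul, Finset.mul_sum]
  refine Finset.sum_congr rfl fun ij hij => ?_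
  rw [mem_antidiagonal] at hij
  rw [← hij, pow_add]
  ring

/-- The group commutator of the two curves, placed in independent variables, has the bracket as
coefficient at `(1, 1)`; its part of that slope is diagonal. -/
theorem lie_mem_IDer (hm : 1 ≤ m) {δ ε : Derivation k A A} (hδ : δ ∈ IDer k A m)
    (hε : ε ∈ IDer k A m) : ⁅δ, ε⁆ ∈ IDer k A m := by
  classical
  obtain ⟨D, hD0, hD1, hD⟩ := exists_isHS_of_mem_IDer hm hδ (0 : Fin 2)
  obtain ⟨E, hE0, hE1, hE⟩ := exists_isHS_of_mem_IDer hm hε (1 : Fin 2)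
  set P := curveSeries (0 : Fin 2) D
  set Q := curveSeries (1 : Fin 2) E
  have hΔ := isLowerSet_Iic (diagExponent (Fin 2) m)
  have hcurve : ∀ (i j : Fin 2) (D E : ℕ → Module.End k A), i ≠ j → E 0 = 1 →
      coeff (diagExponent (Fin 2) 1) (curveSeries i D * curveSeries j E) = D 1 * E 1 := by
    intro i j D E hij h0
    have he : (diagExponent (Fin 2) 1).erase i = Finsupp.single j 1 := by
      ext l
      fin_cases i <;> fin_cases j <;> fin_cases l <;> simp [Finsupp.erase] at hij ⊢
    rw [coeff_curveSeries_mul, he, coeff_single_curveSeries, diagExponent_apply]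
    intro γ hγ
    rw [coeff_curveSeries_of_ne]
    intro h
    rw [h, Finsupp.single_apply, if_neg hij.symm] at hγ
    exact hγ rfl
  have htriv : ∀ (i j : Fin 2) (D : ℕ → Module.End k A), i ≠ j → D 0 = 1 →
      TrivialOn {α : Fin 2 →₀ ℕ | α i = 0} (curveSeries i D) := by
    intro i j D hij h0
    refine ⟨coeff_zero_curveSeries i h0, fun α hα hne => coeff_curveSeries_of_ne i D fun h => hne ?_⟩
    rw [h, (show α i = 0 from hα), Finsupp.single_zero]
  have hlow : ∀ i : Fin 2, IsLowerSet {α : Fin 2 →₀ ℕ | α i = 0} := fun i α β hle hα =>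
    Nat.le_zero.1 ((hle i).trans (le_of_eq hα))
  set X := P * Q * seriesInv P * seriesInv Q with hXdef
  have hX : IsHS _ _ X := ((hD.mul hΔ hE).mul hΔ (hD.inv hΔ)).mul hΔ (hE.inv hΔ)
  have hX0 : TrivialOn {α | α 0 = 0} X := by
    -- The commutator is `P` times a conjugate of `P⁻¹`, hence trivial where `P` is; grouping the
    -- other way handles `Q`.
    have := (htriv 0 1 D (by decide) hD0).mul (hlow 0)
      (((htriv 0 1 D (by decide) hD0).inv (hlow 0)).conj (hlow 0) hE.coeff_zero)
    simpa [X, mul_assoc] using this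
  have hX1 : TrivialOn {α | α 1 = 0} X := by
    have := ((htriv 1 0 E (by decide) hE0).conj (hlow 1) hD.coeff_zero).mul (hlow 1)
      ((htriv 1 0 E (by decide) hE0).inv (hlow 1))
    simpa [X, mul_assoc] using this
  set T : Set (Fin 2 →₀ ℕ) := {α | α 0 = 0} ∪ {α | α 1 = 0}
  have hXT : TrivialOn T X := ⟨hX0.1, fun α hα h => hα.elim (hX0.2 α · h) (hX1.2 α · h)⟩
  have hne : diagExponent (Fin 2) 1 ≠ 0 := by
    rw [← diagExponent_zero]
    exact (diagExponent_injective _).ne one_ne_zero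
  have hlt : ∀ β < diagExponent (Fin 2) 1, β ∈ T := by
    intro β hβ
    have h0 := hβ.le 0
    have h1 := hβ.le 1
    by_contra hcon
    simp only [T, Set.mem_union, Set.mem_ofPred_eq, not_or, diagExponent_apply] at hcon h0 h1
    apply hβ.ne
    ext i
    fin_cases i <;> simp <;> omega
  -- With `ℓ` the first exponent, having the slope `1 / 2` of `(1, 1)` means having equal exponents.
  obtain ⟨Y, hY, -, hYα, hYs⟩ := hX.exists_slope hΔ (Set.finite_Iic _) ((hlow 0).union (hlow 1))
    ((Nat.castAddMonoidHom ℚ).comp (Finsupp.applyAddHom 0)) hne hlt X hXT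
  refine mem_IDer_of_isHS hm hY (fun α hα => hYs α fun h => hα ⟨α 0, ?_⟩) ?_
  · simp [Finsupp.degree_eq_sum, Fin.sum_univ_two] at h
    have h' : α 0 * (1 + 1) = α 0 + α 1 := by exact_mod_cast h
    ext i
    fin_cases i
    · simp
    · simp
      omega
  -- The coefficient at `(1, 1)` is read off from `P Q = X (Q P)`, without expanding the inverses.
  · have hPQ : X * (Q * P) = P * Q := by
      rw [hXdef, mul_assoc _ (seriesInv Q), ← mul_assoc (seriesInv Q),
        seriesInv_mul hE.coeff_zero, one_mul, mul_assoc (P * Q), seriesInv_mul hD.coeff_zero,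
        mul_one]
    have hQP : coeff 0 (Q * P) = 1 := (hE.mul hΔ hD).coeff_zero
    have := hXT.coeff_mul hQP hne hlt
    rw [hPQ, hcurve 0 1 D E (by decide) hE0, hcurve 1 0 E D (by decide) hD0, hD1, hE1] at this
    rw [hYα, ← sub_eq_iff_eq_add.2 this]
    rfl

end IDer

end IntegrableDerivations

/-! ### Symmetrization of multivariate Hasse–Schmidt derivations. -/

section SymmetricSeries

open Finset hiding antidiagonal mem_antidiagonal
open Finset.HasAntidiagonal MvPowerSeries

variable {ι S R : Type*} [Ring S] [CommRing R]

/-- The action of a permutation of the variables on exponents. -/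
noncomputable def permExponent (σ : Equiv.Perm ι) : (ι →₀ ℕ) ≃+ (ι →₀ ℕ) := Finsupp.domCongr σ

@[simp]
theorem permExponent_apply (σ : Equiv.Perm ι) (α : ι →₀ ℕ) (i : ι) :
    permExponent σ α i = α (σ.symm i) := rfl

theorem permExponent_mem_Iic [Finite ι] {σ : Equiv.Perm ι} {m : ℕ} {α : ι →₀ ℕ}
    (h : α ∈ Set.Iic (diagExponent ι m)) : permExponent σ α ∈ Set.Iic (diagExponent ι m) :=
  fun i => h (σ.symm i)

theorem degree_permExponent [Finite ι] (σ : Equiv.Perm ι) (α : ι →₀ ℕ) :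
    (permExponent σ α).degree = α.degree := by
  have := Fintype.ofFinite ι
  simp only [Finsupp.degree_eq_sum, permExponent_apply]
  exact Equiv.sum_comp σ.symm α

theorem degree_lt_degree {α β : ι →₀ ℕ} (h : α < β) : α.degree < β.degree := by
  obtain ⟨γ, rfl⟩ := exists_add_of_le h.le
  have hγ : γ ≠ 0 := by
    rintro rfl
    simp at h
  rw [map_add]
  have : γ.degree ≠ 0 := by simpa [Finsupp.degree_eq_zero_iff] using hγ
  omega

/-- The action of a permutation of the variables on power series. -/
noncomputable def permSeries (σ : Equiv.Perm ι) (X : MvPowerSeries ι S) : MvPowerSeries ι S :=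
  fun α => coeff (permExponent σ α) X

theorem coeff_permSeries (σ : Equiv.Perm ι) (X : MvPowerSeries ι S) (α : ι →₀ ℕ) :
    coeff α (permSeries σ X) = coeff (permExponent σ α) X := rfl

theorem sum_antidiagonal_permExponent {M : Type*} [AddCommMonoid M] [DecidableEq ι]
    (σ : Equiv.Perm ι) (α : ι →₀ ℕ) (f : (ι →₀ ℕ) × (ι →₀ ℕ) → M) :
    ∑ ij ∈ antidiagonal (permExponent σ α), f ij =
      ∑ ij ∈ antidiagonal α, f (permExponent σ ij.1, permExponent σ ij.2) := by
  symm
  refine Finset.sum_bijective (fun ij => (permExponent σ ij.1, permExponent σ ij.2))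
    ((permExponent σ).bijective.prodMap (permExponent σ).bijective) ?_ fun _ _ => rfl
  rintro ⟨β, γ⟩
  simp only [mem_antidiagonal, ← map_add, (permExponent σ).injective.eq_iff]

theorem IsHS.perm {φ : S →+* AddMonoid.End R} [Finite ι] {m : ℕ} {X : MvPowerSeries ι S}
    (hX : IsHS φ (Set.Iic (diagExponent ι m)) X) (σ : Equiv.Perm ι) :
    IsHS φ (Set.Iic (diagExponent ι m)) (permSeries σ X) := by
  classical
  obtain ⟨h0, h⟩ := (isHS_iff φ _ X).1 hX
  refine (isHS_iff φ _ _).2 ⟨by simpa [coeff_permSeries] using h0, fun α hα x y => ?_⟩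
  rw [coeff_permSeries, h _ (permExponent_mem_Iic hα), sum_antidiagonal_permExponent]
  rfl

/-- There is a linear functional that separates the exponents in a box. -/
theorem exists_injOn_Iic (ι : Type*) [Finite ι] (m : ℕ) : ∃ ℓ : (ι →₀ ℕ) →+ ℚ,
    Set.InjOn ℓ (Set.Iic (diagExponent ι m)) := by
  classical
  have := Fintype.ofFinite ι
  let e := Fintype.equivFin ι
  let L : (ι →₀ ℕ) →+ ℕ :=
    -- Exponents in the box are digit sequences in base `m + 1`.
    { toFun := fun α => ∑ i, α i * (m + 1) ^ (e i : ℕ)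
      map_zero' := by simp
      map_add' := fun α β => by simp [add_mul, Finset.sum_add_distrib] }
  refine ⟨(Nat.castAddMonoidHom ℚ).comp L, fun α hα β hβ h => ?_⟩
  have hL : L α = L β := Nat.cast_injective (R := ℚ) h
  have key : ∀ α (hα : α ∈ Set.Iic (diagExponent ι m)), L α = finFunctionFinEquiv
      (fun j : Fin (Fintype.card ι) => (⟨α (e.symm j), Nat.lt_succ_of_le (hα _)⟩ : Fin (m + 1))) := by
    intro α hα
    rw [finFunctionFinEquiv_apply]
    change ∑ i, α i * (m + 1) ^ (e i : ℕ) = _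
    rw [← Equiv.sum_comp e.symm]
    simp
  rw [key α hα, key β hβ] at hL
  have := finFunctionFinEquiv.injective (Fin.ext hL)
  ext i
  simpa using congrArg Fin.val (congrFun this (e i))

/-- The setoid of exponents that differ by a permutation of the variables. -/
def permSetoid (ι : Type*) : Setoid (ι →₀ ℕ) where
  r α β := ∃ σ : Equiv.Perm ι, permExponent σ α = β
  iseqv :=
    { refl := fun α => ⟨1, by ext; rfl⟩
      symm := by
        rintro α β ⟨σ, rfl⟩
        exact ⟨σ.symm, by ext; simp⟩
      trans := by
        rintro α β γ ⟨σ, rfl⟩ ⟨τ, rfl⟩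
        exact ⟨τ * σ, by ext; simp; rfl⟩ }

/-- A multivariate Hasse–Schmidt derivation whose coefficients at squarefree exponents are symmetric
can be modified, away from these exponents, to a symmetric one. -/
theorem IsHS.exists_symmetric {φ : S →+* AddMonoid.End R} [Finite ι] {m : ℕ}
    {G : MvPowerSeries ι S} (hG : IsHS φ (Set.Iic (diagExponent ι m)) G)
    (hsymm : ∀ σ : Equiv.Perm ι, ∀ α ≤ diagExponent ι 1,
      coeff (permExponent σ α) G = coeff α G) :
    ∃ X, IsHS φ (Set.Iic (diagExponent ι m)) X ∧
      (∀ α ∈ Set.Iic (diagExponent ι m), α ≤ diagExponent ι 1 → coeff α X = coeff α G) ∧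
      ∀ σ : Equiv.Perm ι, ∀ α ∈ Set.Iic (diagExponent ι m),
        coeff (permExponent σ α) X = coeff α X := by
  classical
  set Δ := Set.Iic (diagExponent ι m) with hΔdef
  have hΔ : IsLowerSet Δ := isLowerSet_Iic _
  have hfin : Δ.Finite := Set.finite_Iic _
  -- Symmetry is achieved one total degree at a time.
  suffices H : ∀ d : ℕ, ∃ X, IsHS φ Δ X ∧
      (∀ α ∈ Δ, α ≤ diagExponent ι 1 → coeff α X = coeff α G) ∧
      ∀ σ : Equiv.Perm ι, ∀ α ∈ Δ, α.degree < d + 1 → coeff (permExponent σ α) X = coeff α X by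
    obtain ⟨X, h1, h2, h3⟩ := H (diagExponent ι m).degree
    refine ⟨X, h1, h2, fun σ α hα => h3 σ α hα (Nat.lt_succ_of_le ?_)⟩
    exact Finsupp.degree_mono hα
  intro d
  induction d with
  | zero =>
    refine ⟨G, hG, fun _ _ _ => rfl, fun σ α _ hd => ?_⟩
    have : α = 0 := by simpa [Finsupp.degree_eq_zero_iff] using hd
    rw [this, map_zero]
  | succ d ih =>
    obtain ⟨X, hX, hXG, hXs⟩ := ih
    -- The exponents where symmetry already holds and where the correction must be trivial.
    set T : Set (ι →₀ ℕ) := {α | α.degree < d + 1 ∨ α ≤ diagExponent ι 1} ∩ Δ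
    have hT : IsLowerSet T := by
      rintro α β hle ⟨h, hα⟩
      exact ⟨h.imp (Finsupp.degree_mono hle).trans_lt hle.trans, hΔ hle hα⟩
    have hlt : ∀ α ∈ Δ, α.degree = d + 1 → ∀ β < α, β ∈ T := fun α hα hd β hβ =>
      ⟨.inl (hd ▸ degree_lt_degree hβ), hΔ hβ.le hα⟩
    have hne : ∀ α : ι →₀ ℕ, α.degree = d + 1 → α ≠ 0 := by
      rintro α hd rfl
      simp at hd
    -- the series measuring the failure of symmetry
    have hZ : ∀ σ : Equiv.Perm ι, ∃ Z, IsHS φ Δ Z ∧ TrivialOn T Z ∧ ∀ α ∈ Δ, α.degree = d + 1 →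
        coeff α Z = coeff (permExponent σ α) X - coeff α X := by
      intro σ
      have hZ := (hX.inv hΔ).mul hΔ (hX.perm σ)
      have hZT : TrivialOn T (seriesInv X * permSeries σ X) := by
        rw [trivialOn_iff hZ.coeff_zero]
        have : seriesInv X * permSeries σ X - 1 = seriesInv X * (permSeries σ X - X) := by
          rw [mul_sub, seriesInv_mul hX.coeff_zero]
        rw [this]
        refine coeff_mul_eq_zero_of_right hT ?_ _
        rintro α ⟨h | h, hα⟩
        · rw [map_sub, coeff_permSeries, hXs σ α hα h, sub_self]
        · rw [map_sub, coeff_permSeries, hXG α hα h, hXG _ (permExponent_mem_Iic hα)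
            (permExponent_mem_Iic h), hsymm σ α h, sub_self]
      refine ⟨_, hZ, hZT, fun α hα hd => ?_⟩
      have key := coeff_mul_of_lt hX.coeff_zero hZ.coeff_zero (hne α hd) (by
        rintro β γ rfl h1 h2
        exact .inr (hZT.2 _ (hlt _ hα hd _ (lt_add_of_pos_left _ (pos_iff_ne_zero.2 h1))) h2))
      rw [← mul_assoc, mul_seriesInv hX.coeff_zero, one_mul, coeff_permSeries] at key
      rw [key, add_sub_cancel_left]
    obtain ⟨ℓ, hℓ⟩ := exists_injOn_Iic ι m
    -- The families of degree `d + 1` coefficients available for corrections. Products add these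
    -- coefficients, since the factors are trivial in lower degree.
    let W : Set ((ι →₀ ℕ) → S) := {u | ∃ Y, IsHS φ Δ Y ∧ TrivialOn T Y ∧
      ∀ α ∈ Δ, α.degree = d + 1 → coeff α Y = u α}
    have hWsum : ∀ (s : Finset (ι →₀ ℕ)) (u : (ι →₀ ℕ) → ((ι →₀ ℕ) → S)),
        (∀ a ∈ s, u a ∈ W) → ∑ a ∈ s, u a ∈ W := by
      intro s u
      refine Finset.sum_induction u (· ∈ W) ?_ ?_
      · rintro a b ⟨Y, h1, h2, h3⟩ ⟨Y', h1', h2', h3'⟩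
        refine ⟨Y * Y', h1.mul hΔ h1', h2.mul hT h2', fun α hα hd => ?_⟩
        rw [h2.coeff_mul h2'.1 (hne α hd) (hlt α hα hd), h3 α hα hd, h3' α hα hd, Pi.add_apply]
      · refine ⟨1, IsHS.one, TrivialOn.one T, fun α hα hd => ?_⟩
        rw [coeff_one, if_neg (hne α hd), Pi.zero_apply]
    -- In a fixed degree, `ℓ` gives distinct exponents of the box distinct slopes, so `exists_slope`
    -- retains just one coefficient of the asymmetry.
    have hsingle : ∀ (σ : Equiv.Perm ι), ∀ α ∈ Δ, α.degree = d + 1 →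
        Pi.single α (coeff (permExponent σ α) X - coeff α X) ∈ W := by
      intro σ α hα hd
      obtain ⟨Z, h1, h2, h3⟩ := hZ σ
      obtain ⟨Y, hY, hYT, hYα, hYs⟩ :=
        h1.exists_slope hΔ hfin hT ℓ (hne α hd) (hlt α hα hd) Z h2
      refine ⟨Y, hY, hYT, fun β hβ hβd => ?_⟩
      by_cases hβα : β = α
      · subst hβα
        rw [hYα, h3 β hβ hβd, Pi.single_eq_same]
      · rw [Pi.single_eq_of_ne hβα, hYs]
        rw [hd, hβd]
        intro h
        refine hβα (hℓ hβ hα (mul_right_cancel₀ ?_ h))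
        positivity
    -- The correction replaces each coefficient of degree `d + 1` by the one at a chosen
    -- representative of its orbit.
    let rep : (ι →₀ ℕ) → (ι →₀ ℕ) := fun α =>
      Quotient.out (Quotient.mk (permSetoid ι) α)
    have hrep : ∀ α, ∃ σ : Equiv.Perm ι, permExponent σ α = rep α := fun α =>
      (permSetoid ι).symm (Quotient.mk_out (s := permSetoid ι) α)
    have hrep' : ∀ (σ : Equiv.Perm ι) α, rep (permExponent σ α) = rep α := fun σ α =>
      congrArg Quotient.out (Quotient.sound' (s₁ := permSetoid ι)
        ((permSetoid ι).symm ⟨σ, rfl⟩))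
    obtain ⟨Y, hY, hYT, hYv⟩ := hWsum (hfin.toFinset.filter fun α => α.degree = d + 1)
      (fun α => Pi.single α (coeff (rep α) X - coeff α X)) (by
        intro α hα
        simp only [mem_filter, Set.Finite.mem_toFinset] at hα
        obtain ⟨σ, hσ⟩ := hrep α
        rw [← hσ]
        exact hsingle σ α hα.1 hα.2)
    have hYv' : ∀ α ∈ Δ, α.degree = d + 1 → coeff α Y = coeff (rep α) X - coeff α X := by
      intro α hα hd
      rw [hYv α hα hd, Finset.sum_apply, Finset.sum_eq_single α]
      · simp
      · intro β _ hβ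
        rw [Pi.single_eq_of_ne hβ.symm]
      · intro h
        simp [hα, hd] at h
    have hT0 : ∀ α ∈ T, coeff α (X * Y) = coeff α X := by
      intro α hα
      have := coeff_mul_eq_zero_of_right hT ((trivialOn_iff hYT.1).1 hYT) X α hα
      rwa [mul_sub, mul_one, map_sub, sub_eq_zero] at this
    refine ⟨X * Y, hX.mul hΔ hY, fun α hα h => ?_, fun σ α hα hd => ?_⟩
    · rw [hT0 α ⟨.inr h, hα⟩, hXG α hα h]
    · rcases Nat.lt_succ_iff_lt_or_eq.1 hd with hd | hd
      · rw [hT0 α ⟨.inl hd, hα⟩, hT0 _ ⟨.inl ((degree_permExponent σ α).trans_lt hd),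
          permExponent_mem_Iic hα⟩, hXs σ α hα hd]
      · have key : ∀ α ∈ Δ, α.degree = d + 1 → coeff α (X * Y) = coeff (rep α) X := by
          intro α hα hd
          rw [coeff_mul_of_lt hX.coeff_zero hY.coeff_zero (hne α hd), hYv' α hα hd,
            add_sub_cancel]
          rintro β γ rfl h1 h2
          exact .inr (hYT.2 _ (hlt _ hα hd _ (lt_add_of_pos_left _ (pos_iff_ne_zero.2 h1))) h2)
        rw [key α hα hd, key _ (permExponent_mem_Iic hα) ((degree_permExponent σ α).trans hd),
          hrep']

end SymmetricSeries

/-! ### Cancellation in characteristic `p` and integrability of `δ ^ p`. -/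

section CharP

open Finset hiding antidiagonal mem_antidiagonal
open Finset.HasAntidiagonal MvPowerSeries

/-- In characteristic `p`, a sum that is invariant under a permutation of order `p` is the sum over
the fixed points of the permutation. -/
theorem Finset.sum_eq_sum_fixed_of_pow_prime {α M : Type*} [Semiring M] (p : ℕ)
    [Fact p.Prime] (hM : (p : M) = 0) (s : Finset α) (f : α → M) (g : α → α)
    (hgs : ∀ a ∈ s, g a ∈ s) (hg : ∀ a, g^[p] a = a) (hf : ∀ a ∈ s, f (g a) = f a)
    [DecidablePred fun a => g a = a] :
    ∑ a ∈ s, f a = ∑ a ∈ s with g a = a, f a := by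
  classical
  -- Each fibre of `f` is stable under `g`, so modulo `p` it has as many elements as fixed points.
  -- Grouping the sum by values then suffices.
  have hcard : ∀ v : M, #{a ∈ s | f a = v} ≡ #{a ∈ {a ∈ s | g a = a} | f a = v} [MOD p] := by
    intro v
    let t := {a ∈ s | f a = v}
    have ht : ∀ a ∈ t, g a ∈ t := fun a ha => by
      simp only [t, mem_filter] at ha ⊢
      exact ⟨hgs a ha.1, (hf a ha.1).trans ha.2⟩
    let h : Function.End t := fun a => ⟨g a, ht a a.2⟩
    have hiter : ∀ n (a : t), (((h ^ n) a : t) : α) = g^[n] a := by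
      intro n
      induction n with
      | zero => intro a; rfl
      | succ n ih =>
        intro a
        rw [Function.iterate_succ_apply, pow_succ]
        exact ih _
    have he : h ^ p ^ 1 = 1 := by
      rw [pow_one]
      funext a
      exact Subtype.ext ((hiter p a).trans (hg a))
    have := Equiv.Perm.card_fixedPoints_modEq he
    rw [Fintype.card_coe] at this
    refine this.trans (congrArg (· % p) ?_)
    rw [← Fintype.card_coe]
    refine Fintype.card_congr ⟨fun a => ⟨a.1.1, ?_⟩, fun a => ⟨⟨a.1, ?_⟩, ?_⟩, fun _ => rfl,
      fun _ => rfl⟩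
    · have h1 := a.1.2
      have h2 := congrArg Subtype.val a.2
      simp only [t, mem_filter] at h1 ⊢
      exact ⟨⟨h1.1, h2⟩, h1.2⟩
    · have := a.2
      simp only [t, mem_filter] at this ⊢
      exact ⟨this.1.1, this.2⟩
    · have := a.2
      simp only [mem_filter] at this
      exact Subtype.ext this.1.2
  have hcast : ∀ a b : ℕ, a ≡ b [MOD p] → (a : M) = b := by
    intro a b h
    have : ∀ c : ℕ, (c : M) = (c % p : ℕ) := fun c => by
      conv_lhs => rw [← Nat.div_add_mod c p]
      simp [hM]
    rw [this a, this b, h]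
  have hsum : ∀ u ⊆ s, ∑ a ∈ u, f a = ∑ v ∈ s.image f, (#{a ∈ u | f a = v} : M) * v := by
    intro u hu
    rw [← Finset.sum_fiberwise_of_maps_to (t := s.image f)
      (fun a ha => mem_image_of_mem f (hu ha))]
    refine Finset.sum_congr rfl fun v _ => ?_
    rw [Finset.sum_congr rfl fun a ha => (mem_filter.1 ha).2, sum_const, nsmul_eq_mul]
  rw [hsum s Subset.rfl, hsum _ (filter_subset _ _)]
  exact Finset.sum_congr rfl fun v _ => by rw [hcast _ _ (hcard v)]

/-- The diagonal coefficients of a symmetric multivariate Hasse–Schmidt derivation in `p` variables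
in characteristic `p` form a Hasse–Schmidt derivation. -/
theorem IsHS.leibniz_diag_of_symmetric {S R : Type*} [Ring S] [CommRing R] (p : ℕ)
    [Fact p.Prime] (hR : (p : R) = 0) {φ : S →+* AddMonoid.End R} {m : ℕ}
    {X : MvPowerSeries (ZMod p) S} (hX : IsHS φ (Set.Iic (diagExponent (ZMod p) m)) X)
    (hs : ∀ σ : Equiv.Perm (ZMod p), ∀ α ∈ Set.Iic (diagExponent (ZMod p) m),
      coeff (permExponent σ α) X = coeff α X) :
    ∀ n ≤ m, ∀ x y : R, φ (coeff (diagExponent _ n) X) (x * y) = ∑ ij ∈ antidiagonal n,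
      φ (coeff (diagExponent _ ij.1) X) x * φ (coeff (diagExponent _ ij.2) X) y := by
  classical
  intro n hn x y
  have hmem := diagExponent_mem_Iic (ι := ZMod p) hn
  rw [((isHS_iff φ _ X).1 hX).2 _ hmem]
  -- The cyclic shift of the variables: it has order `p` and fixes only the diagonal exponents.
  let σ : Equiv.Perm (ZMod p) := (Equiv.addRight 1).symm
  have hσ : ∀ (α : ZMod p →₀ ℕ) i, permExponent σ α i = α (i + 1) := fun α i => rfl
  have hiter : ∀ (j : ℕ) (α : ZMod p →₀ ℕ) i, (permExponent σ)^[j] α i = α (i + j) := by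
    intro j
    induction j with
    | zero => simp
    | succ j ih =>
      intro α i
      rw [Function.iterate_succ_apply, ih, hσ]
      push_cast
      ring_nf
  have hfix : ∀ α : ZMod p →₀ ℕ, permExponent σ α = α → α = diagExponent _ (α 0) := by
    intro α h
    ext i
    have := hiter (ZMod.val i) α 0
    rw [Function.iterate_fixed h] at this
    simpa using this.symm
  rw [Finset.sum_eq_sum_fixed_of_pow_prime p hR (antidiagonal (diagExponent (ZMod p) n)) _
    (Prod.map (permExponent σ) (permExponent σ))]
  · symm
    refine Finset.sum_bij (fun ij _ => (diagExponent _ ij.1, diagExponent _ ij.2)) ?_ ?_ ?_ ?_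
    · rintro ⟨a, b⟩ h
      rw [mem_antidiagonal] at h
      rw [mem_filter, mem_antidiagonal, ← diagExponent_add, h]
      exact ⟨rfl, Prod.ext (by ext; rfl) (by ext; rfl)⟩
    · rintro ⟨a, b⟩ _ ⟨c, d⟩ _ h
      simp only [Prod.mk.injEq] at h
      rw [diagExponent_injective _ h.1, diagExponent_injective _ h.2]
    · rintro ⟨β, γ⟩ h
      rw [mem_filter, mem_antidiagonal] at h
      obtain ⟨h1, h2⟩ := h
      rw [Prod.map_apply, Prod.mk.injEq] at h2
      have hβ := hfix _ h2.1
      have hγ := hfix _ h2.2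
      refine ⟨(β 0, γ 0), ?_, by rw [← hβ, ← hγ]⟩
      rw [mem_antidiagonal]
      simpa using DFunLike.congr_fun h1 0
    · intro ij _
      rfl
  · rintro ⟨β, γ⟩ h
    rw [mem_antidiagonal] at h ⊢
    rw [Prod.map_fst, Prod.map_snd, ← map_add, h]
    ext; rfl
  · rintro ⟨β, γ⟩
    rw [Prod.map_iterate]
    refine Prod.ext ?_ ?_ <;> ext i <;> simp [hiter]
  · rintro ⟨β, γ⟩ h
    have hβ := hs σ β (isLowerSet_Iic _ (antidiagonal.fst_le h) hmem)
    have hγ := hs σ γ (isLowerSet_Iic _ (antidiagonal.snd_le h) hmem)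
    simp only [Prod.map_apply, hβ, hγ]

open Classical in
theorem coeff_list_prod_curveSeries {ι S : Type*} [Ring S] (D : ℕ → S)
    (l : List ι) (hl : l.Nodup) (α : ι →₀ ℕ) :
    coeff α (l.map fun i => curveSeries i D).prod =
      if ∀ i, α i ≠ 0 → i ∈ l then (l.map fun i => D (α i)).prod else 0 := by
  induction l generalizing α with
  | nil =>
    have : α = 0 ↔ ∀ i, α i ≠ 0 → i ∈ ([] : List ι) := by simp [Finsupp.ext_iff]
    simp only [List.map_nil, List.prod_nil, coeff_one, this]
  | cons i l ih =>
    rw [List.nodup_cons] at hl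
    rw [List.map_cons, List.prod_cons, coeff_curveSeries_mul, ih hl.2, List.map_cons,
      List.prod_cons]
    · have hiff : (∀ j, (α.erase i) j ≠ 0 → j ∈ l) ↔ ∀ j, α j ≠ 0 → j ∈ i :: l := by
        refine forall_congr' fun j => ?_
        by_cases hj : j = i
        · simp [hj]
        · simp [hj, Finsupp.erase_ne]
      have hmap : (l.map fun j => D ((α.erase i) j)) = l.map fun j => D (α j) :=
        List.map_congr_left fun j hj => by
          rw [Finsupp.erase_ne (by rintro rfl; exact hl.1 hj)]
      simp only [hiff, hmap, mul_ite, mul_zero]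
    · intro γ hγ
      rw [ih hl.2, if_neg]
      exact fun h => hl.1 (h i hγ)

/-- The `p`-th power of an `m`-integrable derivation is `m`-integrable. -/
theorem charPow_mem_IDer {k A : Type*} [CommRing k] [CommRing A] [Algebra k A] (p : ℕ)
    [Fact p.Prime] [CharP k p] {m : ℕ} (hm : 1 ≤ m) {δ : Derivation k A A}
    (hδ : δ ∈ IDer k A m) : δ.charPow p ∈ IDer k A m := by
  classical
  obtain ⟨D, h0, h1, h⟩ := (mem_IDer_iff hm).1 hδ
  have hA : (p : A) = 0 := by
    rw [← map_natCast (algebraMap k A) p, CharP.cast_eq_zero, map_zero]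
  let φ := Module.toAddMonoidEnd (Module.End k A) A
  let l : List (ZMod p) := Finset.univ.toList
  let G := (l.map fun i => curveSeries i D).prod
  have hG : IsHS φ (Set.Iic (diagExponent (ZMod p) m)) G := by
    refine List.prod_induction (IsHS φ (Set.Iic (diagExponent (ZMod p) m)))
      (fun X Y hX hY => hX.mul (isLowerSet_Iic _) hY) IsHS.one ?_
    intro X hX
    rw [List.mem_map] at hX
    obtain ⟨i, -, rfl⟩ := hX
    exact isHS_curveSeries (φ := φ) i h0 h
  -- At squarefree exponents only `D 0 = 1` and `D 1 = δ` occur, so the order of the factors is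
  -- irrelevant.
  have hcoeff : ∀ α ≤ diagExponent (ZMod p) 1, coeff α G = (δ : A →ₗ[k] A) ^ α.degree := by
    intro α hα
    rw [coeff_list_prod_curveSeries D l (Finset.nodup_toList _), if_pos (by simp [l])]
    have : ∀ i, D (α i) = (δ : A →ₗ[k] A) ^ α i := by
      intro i
      have := hα i
      rw [diagExponent_apply] at this
      interval_cases α i
      · rw [h0, pow_zero]
      · rw [h1, pow_one]
    simp only [this]
    have hprod : ∀ l : List (ZMod p), (l.map fun i => (δ : A →ₗ[k] A) ^ α i).prod =
        (δ : A →ₗ[k] A) ^ (l.map α).sum := by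
      intro l
      induction l with
      | nil => simp
      | cons i l ih => rw [List.map_cons, List.prod_cons, ih, List.map_cons, List.sum_cons, pow_add]
    rw [hprod, Finsupp.degree_eq_sum, Finset.sum_map_toList]
  obtain ⟨X, hX, hXG, hXs⟩ := hG.exists_symmetric fun σ α hα => by
    rw [hcoeff α hα, hcoeff _ (permExponent_mem_Iic hα), degree_permExponent]
  refine (mem_IDer_iff hm).2 ⟨fun n => coeff (diagExponent _ n) X, ?_, ?_,
    hX.leibniz_diag_of_symmetric p hA hXs⟩
  · simp only [diagExponent_zero, hX.coeff_zero]
  · change coeff (diagExponent _ 1) X = _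
    rw [hXG _ (diagExponent_mem_Iic hm) le_rfl, hcoeff _ le_rfl]
    have : (diagExponent (ZMod p) 1).degree = p := by simp [Finsupp.degree_eq_sum, ZMod.card]
    rw [this]
    rfl

end CharP

/-! ### Jacobson's formula in an associative algebra. -/

section Jacobson

open Polynomial

variable {p : ℕ} [Fact p.Prime]

theorem Commute.sub_pow_prime {E : Type*} [Ring E] (hE : (p : E) = 0) {a b : E}
    (h : Commute a b) : (a - b) ^ p = a ^ p - b ^ p := by
  cases subsingleton_or_nontrivial E
  · exact Subsingleton.elim _ _
  · have := (CharP.charP_iff_prime_eq_zero (R := E) (Fact.out : p.Prime)).2 hE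
    exact sub_pow_char_of_commute p h

/-- By Pascal's rule consecutive values add up to `p.choose (j + 1)`, which vanishes in `E`. -/
theorem cast_choose_prime_pred {E : Type*} [Ring E] (hE : (p : E) = 0) {j : ℕ} (hj : j < p) :
    ((p - 1).choose j : E) = (-1) ^ j := by
  induction j with
  | zero => simp
  | succ j ih =>
    have hp : p.Prime := Fact.out
    have h1 : ((p.choose (j + 1) : ℕ) : E) = 0 := by
      obtain ⟨c, hc⟩ := hp.dvd_choose_self (Nat.succ_ne_zero j) hj
      rw [hc, Nat.cast_mul, hE, zero_mul]
    have h2 : p.choose (j + 1) = (p - 1).choose j + (p - 1).choose (j + 1) := by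
      conv_lhs => rw [← Nat.succ_pred_prime hp]
      exact Nat.choose_succ_succ _ _
    rw [h2, Nat.cast_add, ih (by omega)] at h1
    rw [pow_succ, mul_neg_one]
    exact (neg_eq_of_add_eq_zero_right h1).symm

theorem Commute.sub_pow_prime_pred {E : Type*} [Ring E] (hE : (p : E) = 0) {a b : E}
    (h : Commute a b) : (a - b) ^ (p - 1) = ∑ j ∈ Finset.range p, a ^ j * b ^ (p - 1 - j) := by
  have hp : p.Prime := Fact.out
  have hsign : (-1 : E) ^ (p - 1) = 1 := by
    -- For `p = 2` the sign is harmless because `-1 = 1`.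
    rcases hp.eq_two_or_odd' with rfl | ho
    · have : (1 : E) + 1 = 0 := by rw [one_add_one_eq_two]; exact_mod_cast hE
      simpa using (eq_neg_of_add_eq_zero_left this).symm
    · exact (Nat.Odd.sub_odd ho odd_one).neg_one_pow
  rw [sub_eq_add_neg, h.neg_right.add_pow, Nat.sub_add_cancel hp.one_le]
  refine Finset.sum_congr rfl fun j hj => ?_
  rw [Finset.mem_range] at hj
  rw [cast_choose_prime_pred hE hj, neg_pow b, mul_assoc, mul_assoc,
    ((Commute.neg_one_left (b ^ (p - 1 - j))).pow_left j).eq.symm, ← mul_assoc ((-1) ^ _),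
    ← pow_add, Nat.sub_add_cancel (by omega), hsign, one_mul]

theorem derivative_pow_eq_sum {E : Type*} [Ring E] (u : E[X]) (n : ℕ) :
    derivative (u ^ n) = ∑ j ∈ Finset.range n, u ^ j * derivative u * u ^ (n - 1 - j) := by
  induction n with
  | zero => simp
  | succ n ih =>
    rw [pow_succ, derivative_mul, ih, Finset.sum_range_succ, Finset.sum_mul]
    congr 1
    · refine Finset.sum_congr rfl fun j hj => ?_
      rw [Finset.mem_range] at hj
      rw [mul_assoc _ _ u, ← pow_succ]
      congr 2
      omega
    · simp

variable {k L E : Type*} [CommRing k] [LieRing L] [LieAlgebra k L] [Ring E] [Algebra k E]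

/-- Since `X` is central, `ad (X x + y)` becomes the commutator with `X f x + f y` in `E[X]`. This
brings the coefficients defining `jacobsonS` into an associative ring. -/
theorem map_coeff_ad_pow (f : L →ₗ[k] E)
    (hf : ∀ x y, f ⁅x, y⁆ = f x * f y - f y * f x) (x y z : L) (n : ℕ) : ∀ j : ℕ,
    f ((((X * C (LieAlgebra.ad k L x : Module.End k L) +
      C (LieAlgebra.ad k L y : Module.End k L)) ^ n).coeff j) z) =
    (((LinearMap.mulLeft k (X * C (f x) + C (f y)) -
      LinearMap.mulRight k (X * C (f x) + C (f y)) : Module.End k E[X]) ^ n) (C (f z))).coeff j := by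
  induction n with
  | zero =>
    intro j
    rw [pow_zero, pow_zero, Module.End.one_apply, coeff_one, coeff_C]
    split_ifs <;> simp
  | succ n ih =>
    intro j
    rw [pow_succ', pow_succ', Module.End.mul_apply]
    simp only [LinearMap.sub_apply, LinearMap.mulLeft_apply, LinearMap.mulRight_apply, add_mul,
      mul_add, coeff_add, coeff_sub, coeff_C_mul, coeff_mul_C, mul_assoc]
    rw [← mul_assoc _ X, ← X_mul, mul_assoc]
    cases j with
    | zero =>
      simp only [coeff_X_mul_zero, zero_add, LieAlgebra.ad_apply,
        Module.End.mul_apply, hf, ih]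
    | succ j =>
      simp only [coeff_X_mul, coeff_C_mul, coeff_mul_C, LieAlgebra.ad_apply, LinearMap.add_apply,
        Module.End.mul_apply, hf, map_add, ih]
      abel

theorem map_ad_pow (f : L →ₗ[k] E)
    (hf : ∀ x y, f ⁅x, y⁆ = f x * f y - f y * f x) (x z : L) (n : ℕ) :
    f (((LieAlgebra.ad k L x : Module.End k L) ^ n) z) =
      ((LinearMap.mulLeft k (f x) - LinearMap.mulRight k (f x)) ^ n) (f z) := by
  induction n with
  | zero => simp
  | succ n ih =>
    rw [pow_succ', pow_succ', Module.End.mul_apply, Module.End.mul_apply, LieAlgebra.ad_apply,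
      hf, ih]
    rfl

omit [Fact p.Prime] in
theorem natCast_eq_zero_of_algebra [CharP k p] : (p : E) = 0 := by
  rw [← map_natCast (algebraMap k E) p, CharP.cast_eq_zero, map_zero]

/-- A commutator is the difference of left and right multiplication, which commute, so its `p`-th
power is the difference of their `p`-th powers. -/
theorem lie_pow_prime [CharP k p] (f : L →ₗ[k] E)
    (hf : ∀ x y, f ⁅x, y⁆ = f x * f y - f y * f x) (x z : L) :
    f x ^ p * f z - f z * f x ^ p = f (((LieAlgebra.ad k L x : Module.End k L) ^ p) z) := by
  rw [map_ad_pow f hf, Commute.sub_pow_prime (natCast_eq_zero_of_algebra (k := k))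
    (LinearMap.commute_mulLeft_right _ _), LinearMap.pow_mulLeft, LinearMap.pow_mulRight]
  rfl

/-- Jacobson's formula for the `p`-th power of a sum. -/
theorem add_pow_prime_eq_jacobsonS [CharP k p] (f : L →ₗ[k] E)
    (hf : ∀ x y, f ⁅x, y⁆ = f x * f y - f y * f x) (x y : L) :
    (f x + f y) ^ p = f x ^ p + f y ^ p + f (∑ i ∈ Finset.Ico 1 p, jacobsonS k p i x y) := by
  have hp : p.Prime := Fact.out
  set u : E[X] := X * C (f x) + C (f y) with hu
  have hdeg : u.natDegree ≤ 1 := by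
    rw [hu, X_mul]
    exact natDegree_linear_le
  -- The derivative is the sum of the `u ^ j * f x * u ^ (p - 1 - j)`, which is the expansion of `(L
  -- - R) ^ (p - 1)` in characteristic `p` for left and right multiplication by `u`.
  have hder : derivative (u ^ p) =
      ((LinearMap.mulLeft k u - LinearMap.mulRight k u) ^ (p - 1)) (C (f x)) := by
    rw [Commute.sub_pow_prime_pred (natCast_eq_zero_of_algebra (k := k))
      (LinearMap.commute_mulLeft_right _ _), derivative_pow_eq_sum, LinearMap.sum_apply]
    refine Finset.sum_congr rfl fun j _ => ?_
    rw [LinearMap.pow_mulLeft, LinearMap.pow_mulRight, Module.End.mul_apply,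
      LinearMap.mulLeft_apply, LinearMap.mulRight_apply, ← mul_assoc]
    congr 2
    rw [hu]
    simp [derivative_mul]
  -- Comparing coefficients at `i - 1` gives an equality multiplied by `i`, which is invertible in
  -- `k`.
  have hcoeff : ∀ i ∈ Finset.Ico 1 p, (u ^ p).coeff i = f (jacobsonS k p i x y) := by
    intro i hi
    rw [Finset.mem_Ico] at hi
    have h1 := congrArg f (nsmul_jacobsonS k p i hi.1 hi.2 x y)
    rw [map_coeff_ad_pow f hf, ← hu, ← hder, coeff_derivative, map_nsmul] at h1
    have h2 : ((i - 1 : ℕ) : E) + 1 = (i : E) := by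
      rw [← Nat.cast_succ, Nat.succ_eq_add_one, Nat.sub_add_cancel hi.1]
    rw [h2, Nat.sub_add_cancel hi.1, (Nat.cast_commute i _).eq.symm, ← nsmul_eq_mul,
      ← Nat.cast_smul_eq_nsmul k, ← Nat.cast_smul_eq_nsmul k] at h1
    have hunit : IsUnit (i : k) := by
      rw [CharP.isUnit_natCast_iff (R := k) hp]
      exact Nat.not_dvd_of_pos_of_lt hi.1 hi.2
    exact ((hunit.smul_left_cancel).1 h1).symm
  -- Evaluation at `X = 1`, a ring homomorphism because `1` is central.
  have heval : (f x + f y) ^ p = ∑ i ∈ Finset.range (p + 1), (u ^ p).coeff i := by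
    let ev := eval₂RingHom' (RingHom.id E) 1 fun a => Commute.one_right a
    have h1 : ev u = f x + f y := by
      simp [ev, hu]
    rw [← h1, ← map_pow]
    change eval₂ _ _ _ = _
    rw [eval₂_eq_sum_range' _ (n := p + 1)]
    · simp
    · exact Nat.lt_succ_of_le (natDegree_pow_le.trans (by simpa using Nat.mul_le_mul_left p hdeg))
  have h0 : (u ^ p).coeff 0 = f y ^ p := by
    have := map_pow (constantCoeff (R := E)) u p
    simpa [hu] using this
  have htop : (u ^ p).coeff p = f x ^ p := by
    have := coeff_pow_of_natDegree_le (m := p) hdeg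
    rw [mul_one] at this
    rw [this, hu]
    simp [coeff_C]
  rw [heval, Finset.sum_range_succ, Finset.sum_range_eq_add_Ico _ hp.pos, h0, htop,
    Finset.sum_congr rfl hcoeff, map_sum]
  abel

end Jacobson

/-! ### Hochschild's formula for the `p`-th power of `a δ`. -/

section Hochschild

open Polynomial

/-- The coefficients of `(a δ) ^ n` as a polynomial in `δ`. -/
def smulIterateCoeff {A : Type*} [CommRing A] (a : A) (δ : A → A) : ℕ → ℕ → A
  | 0, 0 => 1
  | 0, _ + 1 => 0
  | n + 1, 0 => a * δ (smulIterateCoeff a δ n 0)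
  | n + 1, i + 1 => a * δ (smulIterateCoeff a δ n (i + 1)) + a * smulIterateCoeff a δ n i

variable {k A : Type*} [CommRing k] [CommRing A] [Algebra k A] (a : A) (δ : Derivation k A A)

theorem smulIterateCoeff_of_lt {n : ℕ} : ∀ {i : ℕ}, n < i → smulIterateCoeff a δ n i = 0 := by
  induction n with
  | zero =>
    rintro (_ | i) h
    · omega
    · rfl
  | succ n ih =>
    rintro (_ | i) h
    · omega
    · simp [smulIterateCoeff, ih (by omega : n < i + 1), ih (by omega : n < i)]

theorem smulIterateCoeff_self (n : ℕ) : smulIterateCoeff a δ n n = a ^ n := by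
  induction n with
  | zero => simp [smulIterateCoeff]
  | succ n ih =>
    rw [smulIterateCoeff, ih, smulIterateCoeff_of_lt a δ n.lt_succ_self, map_zero, mul_zero,
      zero_add, pow_succ']

theorem smulIterateCoeff_succ_zero (n : ℕ) : smulIterateCoeff a δ (n + 1) 0 = 0 := by
  induction n with
  | zero => simp [smulIterateCoeff]
  | succ n ih => rw [smulIterateCoeff, ih, map_zero, mul_zero]

theorem smulIterateCoeff_succ_one (n : ℕ) :
    smulIterateCoeff a δ (n + 1) 1 = (a • δ : Derivation k A A)^[n] a := by
  induction n with
  | zero => simp [smulIterateCoeff]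
  | succ n ih =>
    rw [smulIterateCoeff, ih, smulIterateCoeff_succ_zero, mul_zero, add_zero,
      Function.iterate_succ_apply']
    rfl

/-- The coefficients depend only on `a` and `δ`, so they may be computed in any extension; this is
used for `B = A[X]` and for `B = A`. -/
theorem iterate_smul_derivation {B : Type*} [CommRing B] [Algebra k B] [Algebra A B]
    (δ' : Derivation k B B) (h : ∀ x : A, δ' (algebraMap A B x) = algebraMap A B (δ x))
    (n : ℕ) (b : B) : (algebraMap A B a • δ' : Derivation k B B)^[n] b =
      ∑ i ∈ Finset.range (n + 1), algebraMap A B (smulIterateCoeff a δ n i) * δ'^[i] b := by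
  induction n with
  | zero => simp [smulIterateCoeff]
  | succ n ih =>
    rw [Function.iterate_succ_apply', ih, map_sum]
    have e : ∀ i, (algebraMap A B a • δ') (algebraMap A B (smulIterateCoeff a δ n i) * δ'^[i] b) =
        algebraMap A B (a * δ (smulIterateCoeff a δ n i)) * δ'^[i] b +
        algebraMap A B (a * smulIterateCoeff a δ n i) * δ'^[i + 1] b := by
      intro i
      rw [Function.iterate_succ_apply']
      simp only [Derivation.smul_apply, Derivation.leibniz, smul_eq_mul, h, map_mul]
      ring
    simp only [e, Finset.sum_add_distrib]
    rw [Finset.sum_range_succ' _ (n + 1)]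
    simp only [smulIterateCoeff, map_add, add_mul, Finset.sum_add_distrib]
    rw [Finset.sum_range_succ' _ n, Finset.sum_range_succ
      (fun i => algebraMap A B (a * δ (smulIterateCoeff a δ n (i + 1))) * δ'^[i + 1] b),
      smulIterateCoeff_of_lt a δ n.lt_succ_self]
    simp only [map_zero, mul_zero, zero_mul]
    ring

/-- The derivation `δ + d/dX` of the polynomial ring. -/
noncomputable def polynomialDerivation : Derivation k A[X] A[X] :=
  (PolynomialModule.equivPolynomialSelf (R := A)).toLinearMap.compDer δ.mapCoeffs +
    (derivative' (R := A)).restrictScalars k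

theorem polynomialDerivation_C (x : A) : polynomialDerivation δ (C x) = C (δ x) := by
  simp [polynomialDerivation]

theorem polynomialDerivation_X : polynomialDerivation δ X = 1 := by
  simp [polynomialDerivation]

theorem iterate_polynomialDerivation_X_pow (i j : ℕ) :
    (polynomialDerivation δ)^[i] (X ^ j) = (j.descFactorial i : A[X]) * X ^ (j - i) := by
  induction i with
  | zero => simp
  | succ i ih =>
    rw [Function.iterate_succ_apply', ih, Derivation.leibniz, Derivation.map_natCast, smul_zero,
      add_zero, Derivation.leibniz_pow, polynomialDerivation_X, Nat.descFactorial_succ]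
    simp only [smul_eq_mul, nsmul_eq_mul, mul_one, Nat.cast_mul, Nat.sub_sub]
    ring

variable (p : ℕ) [Fact p.Prime] [CharP k p]

/-- In `A[X]` there is an element with derivative `1`, on whose powers the iterates of the
derivation are explicit. A derivation killing `X` kills `X ^ j`, and this isolates the `j`-th
coefficient. -/
theorem smulIterateCoeff_prime_eq_zero {j : ℕ} (h2 : 2 ≤ j) (hj : j < p) :
    smulIterateCoeff a δ p j = 0 := by
  have hp : p.Prime := Fact.out
  set c := smulIterateCoeff a δ p
  set δ' := polynomialDerivation δ
  -- A derivation, being a combination of derivations, and also the sum of the middle terms of `(a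
  -- δ') ^ p`.
  let Θ : Derivation k A[X] A[X] := (C a • δ').charPow p - (C a ^ p) • δ'.charPow p - C (c 1) • δ'
  have hΘ : ∀ f, Θ f = ∑ i ∈ Finset.Ico 2 p, C (c i) * δ'^[i] f := by
    intro f
    have h := iterate_smul_derivation a δ δ' (polynomialDerivation_C δ) p f
    have hc0 : c 0 = 0 := by
      obtain ⟨n, rfl⟩ := Nat.exists_eq_succ_of_ne_zero hp.ne_zero
      exact smulIterateCoeff_succ_zero a δ n
    have hcp : c p = a ^ p := smulIterateCoeff_self a δ p
    have hs : ∀ g : ℕ → A[X], ∑ i ∈ Finset.range (p + 1), g i =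
        g 0 + (g 1 + ∑ i ∈ Finset.Ico 2 p, g i) + g p := by
      intro g
      rw [Finset.sum_range_succ, Finset.sum_range_eq_add_Ico _ hp.pos,
        Finset.sum_eq_sum_Ico_succ_bot hp.one_lt]
    rw [hs] at h
    simp only [Polynomial.algebraMap_eq] at h
    change _ = C (c 0) * _ + (C (c 1) * _ + ∑ i ∈ Finset.Ico 2 p, C (c i) * _) + C (c p) * _ at h
    rw [hc0, hcp, map_zero, zero_mul, zero_add, Function.iterate_one, map_pow] at h
    simp only [Θ, Derivation.sub_apply, Derivation.smul_apply, Derivation.charPow_apply,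
      smul_eq_mul]
    rw [h]
    ring
  have hX : Θ X = 0 := by
    rw [hΘ]
    refine Finset.sum_eq_zero fun i hi => ?_
    rw [Finset.mem_Ico] at hi
    have := iterate_polynomialDerivation_X_pow δ i 1
    rw [pow_one] at this
    rw [this, Nat.descFactorial_of_lt (by omega)]
    simp
  have hXj : Θ (X ^ j) = 0 := by
    rw [Derivation.leibniz_pow, hX, smul_zero, smul_zero]
  -- In the constant coefficient, terms with `i < j` retain a power of `X` and those with `i > j`
  -- vanish, leaving `j!` times the `j`-th coefficient; `j!` is a unit as `j < p`.
  have key := congrArg (fun f => coeff f 0) ((hΘ (X ^ j)).symm.trans hXj)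
  simp only [finsetSum_coeff, coeff_C_mul, δ', iterate_polynomialDerivation_X_pow,
    coeff_natCast_mul, coeff_X_pow, coeff_zero] at key
  rw [Finset.sum_eq_single j] at key
  · have hunit : IsUnit ((j.factorial : ℕ) : k) := by
      rw [CharP.isUnit_natCast_iff (R := k) hp, hp.dvd_factorial]
      omega
    have hunit' : IsUnit ((j.factorial : ℕ) : A) := by
      simpa using hunit.map (algebraMap k A)
    rw [Nat.descFactorial_self] at key
    simpa [hunit'.mul_left_eq_zero] using key
  · intro i _ hij
    rcases lt_or_gt_of_ne hij with h | h
    · rw [if_neg (by omega)]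
      simp
    · rw [Nat.descFactorial_of_lt h]
      simp
  · intro h
    exact absurd (Finset.mem_Ico.2 ⟨h2, hj⟩) h

/-- Hochschild's formula. -/
theorem Derivation.charPow_smul : (a • δ).charPow p =
    a ^ p • δ.charPow p + ((a • δ : Derivation k A A)^[p - 1] a) • δ := by
  have hp : p.Prime := Fact.out
  ext b
  have h := iterate_smul_derivation a δ δ (fun _ => rfl) p b
  simp only [Algebra.algebraMap_self, RingHom.id_apply] at h
  rw [Finset.sum_range_succ, Finset.sum_range_eq_add_Ico _ hp.pos,
    Finset.sum_eq_sum_Ico_succ_bot hp.one_lt, Finset.sum_eq_zero, smulIterateCoeff_self] at h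
  · obtain ⟨n, hn⟩ := Nat.exists_eq_succ_of_ne_zero hp.ne_zero
    have h0 : smulIterateCoeff a δ p 0 = 0 := hn ▸ smulIterateCoeff_succ_zero a δ n
    have h1 : smulIterateCoeff a δ p 1 = (a • δ : Derivation k A A)^[p - 1] a := by
      rw [hn]
      exact smulIterateCoeff_succ_one a δ n
    rw [h0, h1] at h
    simp only [Derivation.charPow_apply, Derivation.add_apply, Derivation.smul_apply, smul_eq_mul]
    rw [h]
    simp
    ring
  · intro i hi
    rw [Finset.mem_Ico] at hi
    rw [smulIterateCoeff_prime_eq_zero a δ p hi.1 hi.2, zero_mul]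

end Hochschild

/-! ### The restricted Lie–Rinehart structure. -/

section Restricted

variable {k A : Type*} [CommRing k] [CommRing A] [Algebra k A] (p : ℕ) [Fact p.Prime] [CharP k p]

/-- A set of derivations closed under the module operations, brackets and `p`-th powers is a
restricted Lie–Rinehart algebra. -/
theorem isRestrictedLieRinehartSubalgebra_of_closed (S : Set (Derivation k A A)) (h0 : 0 ∈ S)
    (hadd : ∀ δ ∈ S, ∀ ε ∈ S, δ + ε ∈ S) (hsmul : ∀ (a : A), ∀ δ ∈ S, a • δ ∈ S)
    (hlie : ∀ δ ∈ S, ∀ ε ∈ S, ⁅δ, ε⁆ ∈ S) (hpow : ∀ δ ∈ S, δ.charPow p ∈ S) :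
    IsRestrictedLieRinehartSubalgebra k A p S := by
  let L : LieRinehartSubalgebra A (Derivation k A A) :=
    { carrier := S
      add_mem' := fun hδ hε => hadd _ hδ _ hε
      zero_mem' := h0
      smul_mem' := fun a δ hδ => hsmul a δ hδ
      lie_mem' := fun hδ hε => hlie _ hδ _ hε }
  -- An embedding into an associative algebra that turns brackets into commutators and the
  -- `p`-operation into the `p`-th power; the restricted Lie algebra axioms are checked there.
  let f : L →ₗ[k] Module.End k A :=
    { toFun := fun δ => ((δ : Derivation k A A) : A →ₗ[k] A)
      map_add' := fun _ _ => rfl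
      map_smul' := fun _ _ => rfl }
  have hf : ∀ x y, f ⁅x, y⁆ = f x * f y - f y * f x := fun _ _ => rfl
  have hinj : Function.Injective f := fun x y h =>
    Subtype.ext (Derivation.ext fun a => LinearMap.congr_fun h a)
  let pMap : L → L := fun δ => ⟨(δ : Derivation k A A).charPow p, hpow _ δ.2⟩
  have hpMap : ∀ δ, f (pMap δ) = f δ ^ p := fun _ => rfl
  refine ⟨L, rfl, pMap, fun _ => rfl, ?_⟩
  refine { map_smul := ?_, map_add := ?_, ad_map := ?_, map_smul_anchor := ?_ }
  · intro c x
    apply hinj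
    rw [hpMap, map_smul, map_smul, smul_pow, hpMap]
  · intro x y
    apply hinj
    rw [hpMap, map_add, add_pow_prime_eq_jacobsonS f hf, map_add, map_add, hpMap, hpMap]
  · intro x
    ext1 z
    apply hinj
    rw [LieAlgebra.ad_apply, hf, hpMap, lie_pow_prime f hf]
  · intro a x
    exact Subtype.ext (Derivation.charPow_smul a (x : Derivation k A A) p)

end Restricted

theorem mainTheorem4 (k A : Type*) [CommRing k] [CommRing A] [Algebra k A]
    (p : ℕ) [Fact p.Prime] [CharP k p] :
    (∀ m : ℕ, 1 ≤ m →
      (∀ δ : Derivation k A A, δ ∈ IDer k A m → δ.charPow p ∈ IDer k A m) ∧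
      IsRestrictedLieRinehartSubalgebra k A p (IDer k A m)) ∧
    (∀ δ : Derivation k A A, δ ∈ IDerFin k A → δ.charPow p ∈ IDerFin k A) ∧
    IsRestrictedLieRinehartSubalgebra k A p (IDerFin k A) := by
  have hfin : ∀ δ : Derivation k A A, δ ∈ IDerFin k A → δ.charPow p ∈ IDerFin k A :=
    fun δ hδ m hm => charPow_mem_IDer p hm (hδ m hm)
  refine ⟨fun m hm => ⟨fun δ hδ => charPow_mem_IDer p hm hδ, ?_⟩, hfin, ?_⟩
  · exact isRestrictedLieRinehartSubalgebra_of_closed p _ (zero_mem_IDer hm)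
      (fun _ hδ _ hε => add_mem_IDer hm hδ hε) (fun a _ hδ => smul_mem_IDer hm a hδ)
      (fun _ hδ _ hε => lie_mem_IDer hm hδ hε) fun _ hδ => charPow_mem_IDer p hm hδ
  · exact isRestrictedLieRinehartSubalgebra_of_closed p _ (fun m hm => zero_mem_IDer hm)
      (fun _ hδ _ hε m hm => add_mem_IDer hm (hδ m hm) (hε m hm))
      (fun a _ hδ m hm => smul_mem_IDer hm a (hδ m hm))
      (fun _ hδ _ hε m hm => lie_mem_IDer hm (hδ m hm) (hε m hm)) hfin
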